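/- Let $D$ be the open unit disk of $\mathbb{C}$, $dA$ the Lebesgue area measure on $D$ normalized so that $A(D)=1$, and $L_h^2$ the closed subspace of $L^2(D,dA)$ consisting of the (complex-valued) harmonic functions. For suitable $f$ put $$Qf(z)=\int_D\left(\frac1{(1-z\bar w)^2}+\frac1{(1-\bar z w)^2}-1\right)f(w)\,dA(w),$$ which on $L^2(D,dA)$ is the orthogonal projection onto $L_h^2$. A function $u\in L^1(D,dA)$ is called a T-function if the map $h\mapsto Q(uh)$, defined on the harmonic polynomials $h(z)=p(z)+q(\bar z)$, extends to a bounded operator on $L_h^2$; this (unique) extension is the Toeplitz operator $T_u$. For $f,g$ such that $f$, $g$ and $fg$ are T-functions the semicommutator is $(T_f,T_g]=T_fT_g-T_{fg}$. An operator has finite rank if its range is finite dimensional. The statement that a semicommutator $(T_f,T_g]$ has finite rank is understood to include that it is defined, i.e. that $f$, $g$ and $fg$ are T-functions. Let $k_1,k_2\in\mathbb{Z}$ with $k_1k_2\neq0$, let $m\in\mathbb{R}$ with $m\ge-1$, and let $\varphi=\varphi(r)$ be a (complex-valued) radial T-function on $D$ that is not almost everywhere zero. Then the semicommutator $(T_{e^{ik_1\theta}r^m},T_{e^{ik_2\theta}\varphi}]$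 on $L_h^2$ has finite rank if and only if one of the following conditions holds: 1. $m=k_1$, $k_2>\max\{-2,-k_1-2\}$, and $\varphi(r)=Cr^{k_2}$ almost everywhere for some constant $C\in\mathbb{C}\setminus\{0\}$; 2. $m=-k_1$, $k_2<\min\{2,-k_1+2\}$, and $\varphi(r)=Cr^{-k_2}$ almost everywhere for some constant $C\in\mathbb{C}\setminus\{0\}$. -/

import Mathlib

open MeasureTheory

/-- Lebesgue area measure on the open unit disk of `ℂ`, normalized to have total mass one. -/
noncomputable def diskMeasure : Measure ℂ :=
  ENNReal.ofReal (Real.pi)⁻¹ • (volume.restrict (Metric.ball (0 : ℂ) 1))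

/-- The harmonic Bergman space: the classes in `L²(D, dA)` represented by a (complex valued)
function that is harmonic on the open unit disk. -/
noncomputable def harmonicBergman : Submodule ℂ (Lp ℂ 2 diskMeasure) where
  carrier := {f | ∃ h : ℂ → ℂ,
    InnerProductSpace.HarmonicOnNhd h (Metric.ball (0 : ℂ) 1) ∧ ⇑f =ᵐ[diskMeasure] h}
  add_mem' := by
    rintro f g ⟨h₁, hh₁, e₁⟩ ⟨h₂, hh₂, e₂⟩
    exact ⟨h₁ + h₂, hh₁.add hh₂, (Lp.coeFn_add f g).trans (e₁.add e₂)⟩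
  zero_mem' := by
    refine ⟨fun _ => 0, fun x _ => InnerProductSpace.harmonicAt_const 0, ?_⟩
    exact Lp.coeFn_zero ℂ 2 diskMeasure
  smul_mem' := by
    rintro c f ⟨h, hh, e⟩
    refine ⟨((ContinuousLinearMap.mul ℝ ℂ) c) ∘ h, fun x hx => (hh x hx).comp_CLM _, ?_⟩
    exact (Lp.coeFn_smul c f).trans (e.mono fun z hz => by simp [hz])

/-- The projection onto the harmonic Bergman space in its integral form, which makes sense on all
of `L¹(D, dA)`:
`Q f (z) = ∫ (1 / (1 - z w̄)² + 1 / (1 - z̄ w)² - 1) f(w) dA(w)`. -/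
noncomputable def harmonicProj (f : ℂ → ℂ) (z : ℂ) : ℂ :=
  ∫ w, (1 / (1 - z * (starRingEnd ℂ) w) ^ 2 + 1 / (1 - (starRingEnd ℂ) z * w) ^ 2 - 1) * f w
    ∂diskMeasure

/-- `h` is (the class of) a harmonic polynomial `p(z) + q(z̄)`. -/
def IsHarmonicPolynomial (h : harmonicBergman) : Prop :=
  ∃ p q : Polynomial ℂ,
    ⇑(h : Lp ℂ 2 diskMeasure) =ᵐ[diskMeasure] fun z => p.eval z + q.eval ((starRingEnd ℂ) z)

/-- `T` is the Toeplitz operator `T_u` with symbol `u ∈ L¹(D, dA)`: the bounded operator on the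
harmonic Bergman space extending `h ↦ Q (u h)` from the harmonic polynomials, which are dense. -/
def IsToeplitzOperator (u : ℂ → ℂ) (T : harmonicBergman →L[ℂ] harmonicBergman) : Prop :=
  Integrable u diskMeasure ∧
  ∀ h : harmonicBergman, IsHarmonicPolynomial h →
    ⇑(T h : Lp ℂ 2 diskMeasure) =ᵐ[diskMeasure]
      harmonicProj (fun w => u w * (h : Lp ℂ 2 diskMeasure) w)

/-- `u` is a T-function: `u ∈ L¹(D, dA)` and `h ↦ Q (u h)` defines a bounded operator on the
harmonic Bergman space. -/
def IsTFunction (u : ℂ → ℂ) : Prop :=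
  ∃ T : harmonicBergman →L[ℂ] harmonicBergman, IsToeplitzOperator u T

/-- The quasihomogeneous function `e^{ikθ} φ(r)` of degree `k`, where `z = r e^{iθ}`. -/
noncomputable def quasihomogeneous (k : ℤ) (φ : ℝ → ℂ) (z : ℂ) : ℂ :=
  Complex.exp (Complex.I * k * Complex.arg z) * φ ‖z‖

/-- The operator `A` has finite rank: its range is finite dimensional (equivalently, the closure of
its range is). -/
def HasFiniteRank (A : harmonicBergman →L[ℂ] harmonicBergman) : Prop :=
  FiniteDimensional ℂ (LinearMap.range (A : harmonicBergman →ₗ[ℂ] harmonicBergman))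

/-- The semicommutator `T_f T_g - T_{fg}` is defined (the three symbols are T-functions) and has
finite rank. The operators `T_f`, `T_g`, `T_{fg}` are determined by their symbols. -/
def SemicommutatorHasFiniteRank (f g : ℂ → ℂ) : Prop :=
  ∃ Tf Tg Tfg : harmonicBergman →L[ℂ] harmonicBergman,
    IsToeplitzOperator f Tf ∧ IsToeplitzOperator g Tg ∧
    IsToeplitzOperator (fun z => f z * g z) Tfg ∧
    HasFiniteRank (Tf ∘L Tg - Tfg)

/-! On the harmonic monomials `r^|n| e^{inθ}` a symbol `e^{ikθ}φ(r)` acts as a weighted shift of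
degree `k`, with weight `|n+k|+1` times the moment of `φ` of order `|n|+|n+k|`. Hence the
semicommutator is a weighted shift of degree `k₁+k₂`, and it has finite rank iff its weights vanish
for large `|n|` (`hasFiniteRank_iff_of_apply_bergmanMonomial`).

Necessity. Put `n = σN` with `σ = ±1` and `N` large, `κ = σk₂`, `a = σk₁+m`. The absolute values
become linear, and the vanishing of the weight reads `(2N+2κ+2) ∫ t^(2N+κ+1) φ = (2N+2κ+2+a) ∫
t^(2N+κ+1+a) φ`. If `a ≠ 0`, this forces `φ = C t^κ` (`exists_const_of_moment_recursion`):
determinacy of moments turns the recursion into a first order differential equation for a tail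
integral of `φ`. If `a ≠ 0` for both signs, then `φ` is a multiple of both `r^k₂` and `r^(-k₂)`,
which is impossible. So `m = ±k₁`, and the sign with `a = 2σk₁ ≠ 0` determines `φ`. The bounds on
`k₂` express integrability at the origin of the second symbol and of the product.

Sufficiency. Integer exponents above `-2` are at least `-1`; the moments are then `O(1/(d+2))`, so
the shifts are bounded, and the weights of the semicommutator cancel for large `|n|`. Building these
operators needs the monomials to be a Hilbert basis of a complete space (`bergmanBasis`). -/

/-! ### Normalized area measure and polar integration. -/

theorem ae_diskMeasure_iff {p : ℂ → Prop} :
    (∀ᵐ z ∂diskMeasure, p z) ↔ ∀ᵐ z ∂(volume.restrict (Metric.ball (0 : ℂ) 1)), p z := by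
  rw [diskMeasure, Measure.ae_ennreal_smul_measure_iff]
  simp [Real.pi_pos]

theorem integrable_diskMeasure_iff {f : ℂ → ℂ} :
    Integrable f diskMeasure ↔ IntegrableOn f (Metric.ball (0 : ℂ) 1) := by
  rw [diskMeasure, integrable_smul_measure (by simp [Real.pi_pos]) (by simp), IntegrableOn]

theorem integral_diskMeasure (f : ℂ → ℂ) :
    ∫ z, f z ∂diskMeasure = (Real.pi : ℂ)⁻¹ * ∫ z in Metric.ball (0 : ℂ) 1, f z := by
  rw [diskMeasure, integral_smul_measure, ENNReal.toReal_ofReal (by positivity)]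
  simp

instance : IsProbabilityMeasure diskMeasure where
  measure_univ := by
    rw [diskMeasure, Measure.smul_apply, Measure.restrict_apply_univ, Complex.volume_ball,
      smul_eq_mul, ENNReal.ofReal_one, one_pow, one_mul, ENNReal.ofReal_inv_of_pos Real.pi_pos,
      ← ENNReal.ofReal_coe_nnreal, NNReal.coe_real_pi]
    exact ENNReal.inv_mul_cancel (by simp [Real.pi_pos]) (by simp)

theorem ae_diskMeasure_norm_lt_one : ∀ᵐ z ∂diskMeasure, ‖z‖ < 1 := by
  rw [ae_diskMeasure_iff]
  filter_upwards [ae_restrict_mem Metric.isOpen_ball.measurableSet] with z hz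
  simpa using hz

theorem ae_diskMeasure_ne_zero : ∀ᵐ z ∂diskMeasure, z ≠ 0 := by
  rw [ae_diskMeasure_iff]
  exact ae_restrict_of_ae (Measure.ae_ne volume 0)

theorem integrable_diskMeasure_norm_iff {φ : ℝ → ℂ} :
    Integrable (fun z => φ ‖z‖) diskMeasure ↔
      IntegrableOn (fun r : ℝ => (r : ℂ) * φ r) (Set.Ioo 0 1) := by
  rw [integrable_diskMeasure_iff, integrableOn_fun_norm_addHaar]
  simp [Complex.finrank_real_complex]

theorem integral_diskMeasure_norm (φ : ℝ → ℂ) :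
    ∫ z, φ ‖z‖ ∂diskMeasure = 2 * ∫ r in Set.Ioo (0 : ℝ) 1, (r : ℂ) * φ r := by
  have h := integral_fun_norm_addHaar (volume : Measure ℂ) ((Set.Iio (1 : ℝ)).indicator φ)
  have e : (fun z : ℂ => (Set.Iio (1 : ℝ)).indicator φ ‖z‖) =
      (Metric.ball (0 : ℂ) 1).indicator (fun z => φ ‖z‖) := by
    ext z; simp [Set.indicator]
  rw [e, integral_indicator Metric.isOpen_ball.measurableSet] at h
  rw [integral_diskMeasure, h]
  have e2 : ∀ r : ℝ, (r ^ (Module.finrank ℝ ℂ - 1)) • (Set.Iio (1 : ℝ)).indicator φ r =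
      (Set.Iio (1 : ℝ)).indicator (fun r : ℝ => (r : ℂ) * φ r) r := by
    intro r; simp [Complex.finrank_real_complex, Set.indicator]
  simp_rw [e2]
  rw [setIntegral_indicator measurableSet_Iio, Set.Ioi_inter_Iio]
  have hpi : (Real.pi : ℂ) ≠ 0 := by exact_mod_cast Real.pi_ne_zero
  simp [Measure.real, Complex.finrank_real_complex]
  field_simp

/-! ### Quasihomogeneous functions -/

theorem exp_arg_eq_div_norm {z : ℂ} (hz : z ≠ 0) (k : ℤ) :
    Complex.exp (Complex.I * k * Complex.arg z) = (z / ‖z‖) ^ k := by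
  have h : z / ‖z‖ = Complex.exp (Complex.arg z * Complex.I) := by
    rw [div_eq_iff (by simpa using hz), mul_comm, Complex.norm_mul_exp_arg_mul_I]
  rw [h, ← Complex.exp_int_mul]
  ring_nf

theorem norm_exp_I_int_arg (k : ℤ) (z : ℂ) :
    ‖Complex.exp (Complex.I * k * Complex.arg z)‖ = 1 := by
  have : Complex.I * k * Complex.arg z = ((k * Complex.arg z : ℝ) : ℂ) * Complex.I := by
    push_cast; ring
  rw [this, Complex.norm_exp_ofReal_mul_I]

theorem norm_quasihomogeneous (k : ℤ) (φ : ℝ → ℂ) (z : ℂ) :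
    ‖quasihomogeneous k φ z‖ = ‖φ ‖z‖‖ := by
  rw [quasihomogeneous, norm_mul, norm_exp_I_int_arg, one_mul]

theorem quasihomogeneous_mul (j k : ℤ) (φ ψ : ℝ → ℂ) (z : ℂ) :
    quasihomogeneous j φ z * quasihomogeneous k ψ z =
      quasihomogeneous (j + k) (fun r => φ r * ψ r) z := by
  simp only [quasihomogeneous]
  rw [mul_mul_mul_comm, ← Complex.exp_add]
  push_cast; ring_nf

theorem conj_quasihomogeneous (k : ℤ) (φ : ℝ → ℂ) (z : ℂ) :
    (starRingEnd ℂ) (quasihomogeneous k φ z) =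
      quasihomogeneous (-k) (fun r => (starRingEnd ℂ) (φ r)) z := by
  simp [quasihomogeneous, ← Complex.exp_conj]

@[simp] theorem quasihomogeneous_zero (φ : ℝ → ℂ) (z : ℂ) :
    quasihomogeneous 0 φ z = φ ‖z‖ := by
  simp [quasihomogeneous]

theorem measurable_exp_I_int_arg (k : ℤ) :
    Measurable fun z : ℂ => Complex.exp (Complex.I * k * Complex.arg z) := by
  have := Complex.measurable_arg
  fun_prop

theorem integrable_quasihomogeneous_iff (k : ℤ) (φ : ℝ → ℂ) :
    Integrable (quasihomogeneous k φ) diskMeasure ↔ Integrable (fun z => φ ‖z‖) diskMeasure := by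
  refine ⟨fun h => ?_, fun h => ?_⟩
  · refine (h.bdd_mul (f := fun z => Complex.exp (Complex.I * (-k : ℤ) * Complex.arg z)) (c := 1)
      (measurable_exp_I_int_arg _).aestronglyMeasurable
      (.of_forall fun z => (norm_exp_I_int_arg _ z).le)).congr (.of_forall fun z => ?_)
    simp [quasihomogeneous, ← mul_assoc, ← Complex.exp_add]
  · exact h.bdd_mul (c := 1) (measurable_exp_I_int_arg _).aestronglyMeasurable
      (.of_forall fun z => (norm_exp_I_int_arg _ z).le)

theorem measurePreserving_rotation_diskMeasure (a : Circle) :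
    MeasurePreserving (rotation a) diskMeasure diskMeasure := by
  have h := ((rotation a).measurePreserving).restrict_preimage
    (Metric.isOpen_ball (x := (0 : ℂ)) (ε := 1)).measurableSet
  have e : (rotation a) ⁻¹' (Metric.ball (0 : ℂ) 1) = Metric.ball (0 : ℂ) 1 := by
    ext z
    rw [Set.mem_preimage, mem_ball_zero_iff, mem_ball_zero_iff, LinearIsometryEquiv.norm_map]
  rw [e] at h
  exact h.smul_measure _

/-- Rotation by `π/k` preserves the measure and changes the sign of the integrand; no integrability
is needed. -/
theorem integral_quasihomogeneous_of_ne_zero {k : ℤ} (hk : k ≠ 0) (φ : ℝ → ℂ) :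
    ∫ z, quasihomogeneous k φ z ∂diskMeasure = 0 := by
  set a : Circle := Circle.exp (Real.pi / k)
  have ha : (a : ℂ) ^ k = -1 := by
    rw [Circle.coe_exp, ← Complex.exp_int_mul]
    have : (k : ℂ) ≠ 0 := by exact_mod_cast hk
    push_cast
    rw [show (k : ℂ) * (Real.pi / k * Complex.I) = Real.pi * Complex.I by field_simp]
    exact Complex.exp_pi_mul_I
  have h := (measurePreserving_rotation_diskMeasure a).integral_comp
    (rotation a).toMeasurableEquiv.measurableEmbedding (quasihomogeneous k φ)
  have h2 : ∫ z, quasihomogeneous k φ (rotation a z) ∂diskMeasure =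
      ∫ z, -quasihomogeneous k φ z ∂diskMeasure := by
    refine integral_congr_ae ?_
    filter_upwards [ae_diskMeasure_ne_zero] with z hz
    have hz' : (a : ℂ) * z ≠ 0 := mul_ne_zero (Circle.coe_ne_zero a) hz
    simp only [quasihomogeneous, rotation_apply]
    rw [exp_arg_eq_div_norm hz, exp_arg_eq_div_norm hz', norm_mul, Circle.norm_coe, one_mul,
      mul_div_assoc, mul_zpow, ha]
    ring
  rw [h2, integral_neg] at h
  exact self_eq_neg.mp h.symm

/-! ### Harmonic monomials -/

/-- The harmonic monomial `r^{|k|} e^{ikθ}`: `z^k` for `k ≥ 0` and `z̄^{-k}` for `k ≤ 0`. -/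
noncomputable def harmonicMonomial (k : ℤ) : ℂ → ℂ :=
  quasihomogeneous k (fun r => (r : ℂ) ^ k.natAbs)

theorem norm_harmonicMonomial (k : ℤ) (z : ℂ) : ‖harmonicMonomial k z‖ = ‖z‖ ^ k.natAbs := by
  simp [harmonicMonomial, norm_quasihomogeneous]

theorem harmonicMonomial_natCast (n : ℕ) (z : ℂ) : harmonicMonomial n z = z ^ n := by
  rcases eq_or_ne z 0 with rfl | hz
  · rcases eq_or_ne n 0 with rfl | hn <;> simp [harmonicMonomial, quasihomogeneous, *]
  · have : (‖z‖ : ℂ) ≠ 0 := by simpa using hz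
    rw [harmonicMonomial, quasihomogeneous, exp_arg_eq_div_norm hz]
    simp only [zpow_natCast, Int.natAbs_natCast]
    rw [← mul_pow, div_mul_cancel₀ _ this]

theorem conj_harmonicMonomial (k : ℤ) (z : ℂ) :
    (starRingEnd ℂ) (harmonicMonomial k z) = harmonicMonomial (-k) z := by
  simp [harmonicMonomial, conj_quasihomogeneous]

theorem harmonicMonomial_neg_natCast (n : ℕ) (z : ℂ) :
    harmonicMonomial (-n) z = (starRingEnd ℂ) z ^ n := by
  rw [← conj_harmonicMonomial, harmonicMonomial_natCast, map_pow]

theorem continuous_harmonicMonomial (k : ℤ) : Continuous (harmonicMonomial k) := by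
  obtain ⟨n, rfl | rfl⟩ := k.eq_nat_or_neg
  · rw [show harmonicMonomial n = fun z => z ^ n from funext (harmonicMonomial_natCast n)]
    fun_prop
  · rw [show harmonicMonomial (-n) = fun z => (starRingEnd ℂ) z ^ n from
      funext (harmonicMonomial_neg_natCast n)]
    fun_prop

theorem norm_harmonicMonomial_le_one (k : ℤ) :
    ∀ᵐ z ∂diskMeasure, ‖harmonicMonomial k z‖ ≤ 1 := by
  filter_upwards [ae_diskMeasure_norm_lt_one] with z hz
  rw [norm_harmonicMonomial]
  exact pow_le_one₀ (norm_nonneg _) hz.le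

theorem integral_quasihomogeneous_mul_conj_harmonicMonomial (k j : ℤ) (φ : ℝ → ℂ) :
    ∫ z, quasihomogeneous k φ z * (starRingEnd ℂ) (harmonicMonomial j z) ∂diskMeasure =
      if k = j then ∫ z, φ ‖z‖ * (‖z‖ : ℂ) ^ j.natAbs ∂diskMeasure else 0 := by
  simp_rw [conj_harmonicMonomial, harmonicMonomial, quasihomogeneous_mul]
  split_ifs with h
  · subst h; simp
  · exact integral_quasihomogeneous_of_ne_zero (by omega) _

/-! ### Expansion of the reproducing kernel and of `harmonicProj`. -/

theorem hasSum_succ_mul_pow {x : ℂ} (hx : ‖x‖ < 1) :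
    HasSum (fun n : ℕ => ((n : ℂ) + 1) * x ^ n) (1 / (1 - x) ^ 2) := by
  simpa using hasSum_choose_mul_geometric_of_norm_lt_one 1 hx

theorem summable_succ_mul_pow {x : ℝ} (h0 : 0 ≤ x) (hx : x < 1) :
    Summable (fun n : ℕ => ((n : ℝ) + 1) * x ^ n) := by
  simpa using summable_choose_mul_geometric_of_norm_lt_one 1
    (show ‖x‖ < 1 by rwa [Real.norm_of_nonneg h0])

theorem summable_natAbs_succ_mul_pow {x : ℝ} (h0 : 0 ≤ x) (hx : x < 1) :
    Summable (fun k : ℤ => ((k.natAbs : ℝ) + 1) * x ^ k.natAbs) := by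
  refine Summable.of_nat_of_neg ?_ ?_ <;> simpa using summable_succ_mul_pow h0 hx

/-- The two squares expand over `k ≥ 0` and `k ≤ 0`; the `-1` removes the second copy of the term `k
= 0`. -/
theorem hasSum_harmonicKernel {z w : ℂ} (hz : ‖z‖ < 1) (hw : ‖w‖ < 1) :
    HasSum (fun k : ℤ => ((k.natAbs : ℂ) + 1) * harmonicMonomial k z *
        (starRingEnd ℂ) (harmonicMonomial k w))
      (1 / (1 - z * (starRingEnd ℂ) w) ^ 2 + 1 / (1 - (starRingEnd ℂ) z * w) ^ 2 - 1) := by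
  have hzw : ‖z‖ * ‖w‖ < 1 := by nlinarith [norm_nonneg z, norm_nonneg w]
  have h := HasSum.of_nat_of_neg
    (f := fun k : ℤ => ((k.natAbs : ℂ) + 1) * harmonicMonomial k z *
        (starRingEnd ℂ) (harmonicMonomial k w))
    (g := 1 / (1 - z * (starRingEnd ℂ) w) ^ 2) (g' := 1 / (1 - (starRingEnd ℂ) z * w) ^ 2) ?_ ?_
  · have e : harmonicMonomial 0 = fun _ => 1 :=
      funext fun z => by simpa using harmonicMonomial_natCast 0 z
    simpa [e] using h
  · simpa [harmonicMonomial_natCast, mul_pow, mul_assoc] using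
      hasSum_succ_mul_pow (x := z * (starRingEnd ℂ) w) (by simpa using hzw)
  · simpa [harmonicMonomial_neg_natCast, mul_pow, mul_assoc] using
      hasSum_succ_mul_pow (x := (starRingEnd ℂ) z * w) (by simpa using hzw)

theorem integrable_mul_conj_harmonicMonomial {f : ℂ → ℂ} (hf : Integrable f diskMeasure) (k : ℤ) :
    Integrable (fun w => f w * (starRingEnd ℂ) (harmonicMonomial k w)) diskMeasure := by
  refine hf.mul_bdd (c := 1) ?_ ?_
  · exact (Complex.continuous_conj.comp (continuous_harmonicMonomial k)).aestronglyMeasurable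
  · filter_upwards [norm_harmonicMonomial_le_one k] with z hz
    simpa using hz

theorem integrable_mul_harmonicMonomial {f : ℂ → ℂ} (hf : Integrable f diskMeasure) (k : ℤ) :
    Integrable (fun w => f w * harmonicMonomial k w) diskMeasure := by
  refine (integrable_mul_conj_harmonicMonomial hf (-k)).congr (.of_forall fun w => ?_)
  simp [conj_harmonicMonomial]

/-- For fixed `z` the terms have `L¹` norm at most `(|k|+1)|z|^|k| ‖f‖₁`, so termwise integration is
allowed even for `f` merely in `L¹`. -/
theorem hasSum_harmonicProj {f : ℂ → ℂ} (hf : Integrable f diskMeasure) {z : ℂ} (hz : ‖z‖ < 1) :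
    HasSum (fun k : ℤ => ((k.natAbs : ℂ) + 1) * harmonicMonomial k z *
        ∫ w, f w * (starRingEnd ℂ) (harmonicMonomial k w) ∂diskMeasure) (harmonicProj f z) := by
  have hint := fun k : ℤ => (integrable_mul_conj_harmonicMonomial hf k).const_mul
    (((k.natAbs : ℂ) + 1) * harmonicMonomial k z)
  have h := hasSum_integral_of_summable_integral_norm hint ?_
  · simp_rw [integral_const_mul] at h
    rw [show harmonicProj f z = ∫ w, ∑' k : ℤ, ((k.natAbs : ℂ) + 1) * harmonicMonomial k z *
      (f w * (starRingEnd ℂ) (harmonicMonomial k w)) ∂diskMeasure from ?_]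
    · exact h
    refine integral_congr_ae ?_
    filter_upwards [ae_diskMeasure_norm_lt_one] with w hw
    rw [← ((hasSum_harmonicKernel hz hw).mul_right (f w)).tsum_eq]
    exact tsum_congr fun k => by ring
  · refine Summable.of_nonneg_of_le (fun k => integral_nonneg fun w => norm_nonneg (_ : ℂ))
      (fun k => ?_)
      ((summable_natAbs_succ_mul_pow (norm_nonneg z) hz).mul_right (∫ w, ‖f w‖ ∂diskMeasure))
    rw [← integral_const_mul (μ := diskMeasure)]
    refine integral_mono_ae (hint k).norm (hf.norm.const_mul _) ?_
    filter_upwards [norm_harmonicMonomial_le_one k] with w hw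
    simp only [norm_mul, RCLike.norm_conj, norm_harmonicMonomial k z]
    have : ‖(k.natAbs : ℂ) + 1‖ = (k.natAbs : ℝ) + 1 := by
      exact_mod_cast Complex.norm_natCast (k.natAbs + 1)
    rw [this]
    refine mul_le_mul_of_nonneg_left ?_ (by positivity)
    exact mul_le_of_le_one_right (norm_nonneg _) hw

theorem harmonicProj_congr_ae {f g : ℂ → ℂ} (h : f =ᵐ[diskMeasure] g) :
    harmonicProj f = harmonicProj g := by
  ext z
  refine integral_congr_ae ?_
  filter_upwards [h] with w hw
  rw [hw]

/-- The radial moment `∫ φ(|z|) |z|^d dA`. -/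
noncomputable def radialMoment (φ : ℝ → ℂ) (d : ℕ) : ℂ :=
  ∫ z, φ ‖z‖ * (‖z‖ : ℂ) ^ d ∂diskMeasure

theorem harmonicProj_quasihomogeneous_mul_harmonicMonomial {φ : ℝ → ℂ}
    (hφ : Integrable (fun z => φ ‖z‖) diskMeasure) (k n : ℤ) {z : ℂ} (hz : ‖z‖ < 1) :
    harmonicProj (fun w => quasihomogeneous k φ w * harmonicMonomial n w) z =
      ((n + k).natAbs + 1) * radialMoment φ (n.natAbs + (n + k).natAbs) *
        harmonicMonomial (n + k) z := by
  have h := hasSum_harmonicProj (integrable_mul_harmonicMonomial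
    ((integrable_quasihomogeneous_iff k φ).2 hφ) n) hz
  refine h.unique ?_
  simp_rw [harmonicMonomial.eq_def n, quasihomogeneous_mul,
    integral_quasihomogeneous_mul_conj_harmonicMonomial]
  convert hasSum_ite_eq (n + k) _ using 2 with j
  split_ifs with h1 h2 h2
  · subst h2
    rw [mul_right_comm, radialMoment]
    simp only [pow_add, mul_assoc]
  · omega
  · omega
  · simp

/-! ### The harmonic monomials as elements of the harmonic Bergman space -/

theorem memLp_harmonicMonomial (k : ℤ) : MemLp (harmonicMonomial k) 2 diskMeasure :=
  MemLp.of_bound (continuous_harmonicMonomial k).aestronglyMeasurable 1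
    (norm_harmonicMonomial_le_one k)

theorem harmonicOnNhd_harmonicMonomial (k : ℤ) (s : Set ℂ) :
    InnerProductSpace.HarmonicOnNhd (harmonicMonomial k) s := by
  intro x _
  have h (n : ℕ) : AnalyticAt ℂ (fun z : ℂ => z ^ n) x := by fun_prop
  obtain ⟨n, rfl | rfl⟩ := k.eq_nat_or_neg
  · rw [show harmonicMonomial n = fun z => z ^ n from funext (harmonicMonomial_natCast n)]
    exact (h n).harmonicAt
  · rw [show harmonicMonomial (-n) = (starRingEnd (ℂ → ℂ)) (fun z : ℂ => z ^ n) from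
      funext fun z => by simp [harmonicMonomial_neg_natCast]]
    exact (h n).harmonicAt_conj

/-- The class of `harmonicMonomial k` in the harmonic Bergman space. -/
noncomputable def bergmanMonomial (k : ℤ) : harmonicBergman :=
  ⟨(memLp_harmonicMonomial k).toLp, harmonicMonomial k, harmonicOnNhd_harmonicMonomial k _,
    (memLp_harmonicMonomial k).coeFn_toLp⟩

theorem coeFn_bergmanMonomial (k : ℤ) :
    ⇑(bergmanMonomial k : Lp ℂ 2 diskMeasure) =ᵐ[diskMeasure] harmonicMonomial k :=
  (memLp_harmonicMonomial k).coeFn_toLp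

theorem harmonicBergman_ext {f g : harmonicBergman}
    (h : ⇑(f : Lp ℂ 2 diskMeasure) =ᵐ[diskMeasure] ⇑(g : Lp ℂ 2 diskMeasure)) : f = g :=
  Subtype.ext (Lp.ext h)

theorem isHarmonicPolynomial_bergmanMonomial (k : ℤ) :
    IsHarmonicPolynomial (bergmanMonomial k) := by
  obtain ⟨n, rfl | rfl⟩ := k.eq_nat_or_neg
  · refine ⟨Polynomial.X ^ n, 0, (coeFn_bergmanMonomial _).trans (.of_forall fun z => ?_)⟩
    simp [harmonicMonomial_natCast]
  · refine ⟨0, Polynomial.X ^ n, (coeFn_bergmanMonomial _).trans (.of_forall fun z => ?_)⟩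
    simp [harmonicMonomial_neg_natCast]

theorem integral_norm_pow_diskMeasure (d : ℕ) :
    ∫ z, (‖z‖ : ℂ) ^ d ∂diskMeasure = 2 / (d + 2) := by
  rw [integral_diskMeasure_norm (fun r => (r : ℂ) ^ d), ← integral_Ioc_eq_integral_Ioo,
    ← intervalIntegral.integral_of_le zero_le_one]
  have : ∀ r : ℝ, (r : ℂ) * (r : ℂ) ^ d = ((r ^ (d + 1) : ℝ) : ℂ) := by
    intro r; push_cast; ring
  simp_rw [this]
  rw [intervalIntegral.integral_ofReal, integral_pow]
  push_cast
  simp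
  ring

theorem inner_eq_integral (f : Lp ℂ 2 diskMeasure) (k : ℤ) :
    inner ℂ (bergmanMonomial k : Lp ℂ 2 diskMeasure) f =
      ∫ z, f z * (starRingEnd ℂ) (harmonicMonomial k z) ∂diskMeasure := by
  rw [L2.inner_def]
  refine integral_congr_ae ?_
  filter_upwards [coeFn_bergmanMonomial k] with z hz
  rw [hz]; simp

theorem inner_bergmanMonomial (j k : ℤ) :
    inner ℂ (bergmanMonomial j) (bergmanMonomial k) =
      if j = k then 1 / ((k.natAbs : ℂ) + 1) else 0 := by
  rw [Submodule.coe_inner, inner_eq_integral]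
  have : ∫ z, (bergmanMonomial k : Lp ℂ 2 diskMeasure) z *
        (starRingEnd ℂ) (harmonicMonomial j z) ∂diskMeasure =
      ∫ z, harmonicMonomial k z * (starRingEnd ℂ) (harmonicMonomial j z) ∂diskMeasure := by
    refine integral_congr_ae ?_
    filter_upwards [coeFn_bergmanMonomial k] with z hz
    rw [hz]
  rw [this, harmonicMonomial.eq_def k, integral_quasihomogeneous_mul_conj_harmonicMonomial]
  rcases eq_or_ne j k with rfl | h
  · simp only [if_true, ← pow_add]
    rw [integral_norm_pow_diskMeasure]
    have h1 : (j.natAbs : ℂ) + 1 ≠ 0 := by norm_cast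
    rw [show ((j.natAbs + j.natAbs : ℕ) : ℂ) + 2 = 2 * (j.natAbs + 1) by push_cast; ring]
    field_simp
  · simp [h, h.symm]

/-- The normalized harmonic monomials. -/
noncomputable def bergmanUnit (k : ℤ) : harmonicBergman :=
  ((Real.sqrt (k.natAbs + 1) : ℝ) : ℂ) • bergmanMonomial k

theorem orthonormal_bergmanUnit : Orthonormal ℂ bergmanUnit := by
  rw [orthonormal_iff_ite]
  intro j k
  have h1 := inner_smul_left (𝕜 := ℂ) (bergmanMonomial j)
    (((Real.sqrt (k.natAbs + 1) : ℝ) : ℂ) • bergmanMonomial k)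
    ((Real.sqrt (j.natAbs + 1) : ℝ) : ℂ)
  have h2 := inner_smul_right (𝕜 := ℂ) (bergmanMonomial j) (bergmanMonomial k)
    ((Real.sqrt (k.natAbs + 1) : ℝ) : ℂ)
  rw [bergmanUnit, bergmanUnit]
  refine h1.trans ?_
  rw [h2, inner_bergmanMonomial]
  split_ifs with h
  · subst h
    rw [Complex.conj_ofReal, ← mul_assoc, ← Complex.ofReal_mul,
      Real.mul_self_sqrt (by positivity)]
    have : (j.natAbs : ℂ) + 1 ≠ 0 := by norm_cast
    push_cast
    field_simp
  · simp

theorem bergmanMonomial_eq_smul_bergmanUnit (k : ℤ) :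
    bergmanMonomial k = ((Real.sqrt (k.natAbs + 1) : ℝ) : ℂ)⁻¹ • bergmanUnit k := by
  have : ((Real.sqrt (k.natAbs + 1) : ℝ) : ℂ) ≠ 0 := by
    rw [Complex.ofReal_ne_zero]; positivity
  rw [bergmanUnit, smul_smul, inv_mul_cancel₀ this, one_smul]

theorem bergmanMonomial_ne_zero (k : ℤ) : bergmanMonomial k ≠ 0 := by
  intro h
  have := inner_bergmanMonomial k k
  rw [h, inner_zero_left, if_pos rfl] at this
  exact one_div_ne_zero (by norm_cast) this.symm

theorem linearIndependent_bergmanMonomial : LinearIndependent ℂ bergmanMonomial := by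
  refine linearIndependent_of_ne_zero_of_inner_eq_zero bergmanMonomial_ne_zero fun j k h => ?_
  exact (inner_bergmanMonomial j k).trans (if_neg h)

theorem span_range_bergmanUnit :
    Submodule.span ℂ (Set.range bergmanUnit) = Submodule.span ℂ (Set.range bergmanMonomial) := by
  apply le_antisymm <;> rw [Submodule.span_le] <;> rintro _ ⟨k, rfl⟩
  · exact Submodule.smul_mem _ _ (Submodule.subset_span ⟨k, rfl⟩)
  · rw [bergmanMonomial_eq_smul_bergmanUnit]
    exact Submodule.smul_mem _ _ (Submodule.subset_span ⟨k, rfl⟩)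

/-! ### Toeplitz operators on the monomials -/

theorem IsToeplitzOperator.apply_bergmanMonomial {k : ℤ} {φ : ℝ → ℂ}
    {T : harmonicBergman →L[ℂ] harmonicBergman}
    (hT : IsToeplitzOperator (quasihomogeneous k φ) T) (n : ℤ) :
    T (bergmanMonomial n) = ((((n + k).natAbs : ℂ) + 1) *
      radialMoment φ (n.natAbs + (n + k).natAbs)) • bergmanMonomial (n + k) := by
  apply harmonicBergman_ext
  refine (hT.2 _ (isHarmonicPolynomial_bergmanMonomial n)).trans ?_
  have e : (fun w => quasihomogeneous k φ w * (bergmanMonomial n : Lp ℂ 2 diskMeasure) w)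
      =ᵐ[diskMeasure] fun w => quasihomogeneous k φ w * harmonicMonomial n w := by
    filter_upwards [coeFn_bergmanMonomial n] with w hw
    rw [hw]
  rw [harmonicProj_congr_ae e]
  refine .trans ?_ (Lp.coeFn_smul _ _).symm
  filter_upwards [ae_diskMeasure_norm_lt_one, coeFn_bergmanMonomial (n + k)] with z hz h2
  rw [harmonicProj_quasihomogeneous_mul_harmonicMonomial
    ((integrable_quasihomogeneous_iff k φ).1 hT.1) k n hz, Pi.smul_apply, h2, smul_eq_mul]

/-! ### Harmonic series, closedness of the harmonic Bergman space, and its Hilbert basis. -/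

theorem differentiableOn_ball_tsum_mul_pow {a : ℕ → ℂ}
    (ha : ∀ x : ℝ, 0 ≤ x → x < 1 → Summable fun n => ‖a n‖ * x ^ n) :
    DifferentiableOn ℂ (fun z => ∑' n, a n * z ^ n) (Metric.ball 0 1) := by
  intro z hz
  rw [mem_ball_zero_iff] at hz
  obtain ⟨r, hr, hr1⟩ := exists_between hz
  have h := Complex.differentiableOn_tsum_of_summable_norm (U := Metric.ball (0 : ℂ) r)
    (F := fun n z => a n * z ^ n) (ha r ((norm_nonneg z).trans hr.le) hr1)
    (fun n => by fun_prop) Metric.isOpen_ball (fun n w hw => by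
      rw [mem_ball_zero_iff] at hw
      rw [norm_mul, norm_pow]
      gcongr)
  exact (h.differentiableAt (Metric.isOpen_ball.mem_nhds (by simpa using hr))).differentiableWithinAt

/-- The indices `≥ 0` give a holomorphic function and the indices `≤ 0` the conjugate of one; the
constant term, counted twice, is subtracted. -/
theorem harmonicOnNhd_tsum {a : ℤ → ℂ}
    (ha : ∀ x : ℝ, 0 ≤ x → x < 1 → Summable fun k => ‖a k‖ * x ^ k.natAbs) :
    InnerProductSpace.HarmonicOnNhd (fun z => ∑' k, a k * harmonicMonomial k z)
      (Metric.ball 0 1) := by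
  have hinj : Function.Injective (fun n : ℕ => -(n : ℤ)) := fun m n h => by simpa using h
  have h1 : ∀ x : ℝ, 0 ≤ x → x < 1 → Summable fun n : ℕ => ‖a n‖ * x ^ n := fun x h0 hx => by
    simpa [Function.comp_def] using (ha x h0 hx).comp_injective Nat.cast_injective
  have h2 : ∀ x : ℝ, 0 ≤ x → x < 1 →
      Summable fun n : ℕ => ‖(starRingEnd ℂ) (a (-n))‖ * x ^ n := fun x h0 hx => by
    simpa [Function.comp_def] using (ha x h0 hx).comp_injective hinj
  intro z hz
  have hF := ((differentiableOn_ball_tsum_mul_pow h1).analyticOnNhd Metric.isOpen_ball z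
    hz).harmonicAt
  have hG := ((differentiableOn_ball_tsum_mul_pow h2).analyticOnNhd Metric.isOpen_ball z
    hz).harmonicAt_conj
  refine (InnerProductSpace.harmonicAt_congr_nhds ?_).2
    ((hF.add hG).sub (InnerProductSpace.harmonicAt_const (a 0)))
  filter_upwards [Metric.isOpen_ball.mem_nhds hz] with w hw
  rw [mem_ball_zero_iff] at hw
  have s1 : Summable fun n : ℕ => a n * w ^ n :=
    .of_norm (by simpa using h1 _ (norm_nonneg w) hw)
  have s2 : Summable fun n : ℕ => (starRingEnd ℂ) (a (-n)) * w ^ n :=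
    .of_norm (by simpa using h2 _ (norm_nonneg w) hw)
  have key := HasSum.of_nat_of_neg (f := fun k : ℤ => a k * harmonicMonomial k w)
    (g := ∑' n : ℕ, a n * w ^ n)
    (g' := (starRingEnd ℂ) (∑' n : ℕ, (starRingEnd ℂ) (a (-n)) * w ^ n)) ?_ ?_
  · have e : harmonicMonomial 0 w = 1 := by simpa using harmonicMonomial_natCast 0 w
    rw [key.tsum_eq]
    simp [e]
  · simpa [harmonicMonomial_natCast] using s1.hasSum
  · simpa [harmonicMonomial_neg_natCast, Function.comp_def] using
      Complex.hasSum_conj'.2 s2.hasSum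

/-- If `Re h = Re F` and `Im h = Re G` with `F`, `G` holomorphic, then `h` is `(F + iG)/2` plus the
conjugate of `(F - iG)/2`; both have Taylor series on the disk. -/
theorem exists_hasSum_of_harmonicOnNhd {h : ℂ → ℂ}
    (hh : InnerProductSpace.HarmonicOnNhd h (Metric.ball 0 1)) :
    ∃ a : ℤ → ℂ, ∀ z, ‖z‖ < 1 → HasSum (fun k => a k * harmonicMonomial k z) (h z) := by
  obtain ⟨F, hF, eF⟩ := InnerProductSpace.HarmonicOnNhd.exists_analyticOnNhd_ball_re_eq
    (hh.comp_CLM Complex.reCLM)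
  obtain ⟨G, hG, eG⟩ := InnerProductSpace.HarmonicOnNhd.exists_analyticOnNhd_ball_re_eq
    (hh.comp_CLM Complex.imCLM)
  have taylor : ∀ f : ℂ → ℂ, AnalyticOnNhd ℂ f (Metric.ball 0 1) →
      ∃ c : ℕ → ℂ, ∀ z, ‖z‖ < 1 → HasSum (fun n => c n * z ^ n) (f z) := by
    intro f hf
    refine ⟨fun n => (n.factorial : ℂ)⁻¹ * iteratedDeriv n f 0, fun z hz => ?_⟩
    have := Complex.hasSum_taylorSeries_on_ball hf.differentiableOn
      (show z ∈ Metric.ball 0 1 by simpa using hz)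
    refine this.congr_fun fun n => ?_
    simp only [sub_zero, smul_eq_mul]
    ring
  obtain ⟨α, hα⟩ := taylor (fun z => (F z + Complex.I * G z) / 2)
    (fun z hz => by have := hF z hz; have := hG z hz; fun_prop)
  obtain ⟨β, hβ⟩ := taylor (fun z => (F z - Complex.I * G z) / 2)
    (fun z hz => by have := hF z hz; have := hG z hz; fun_prop)
  have hinj : Function.Injective (fun n : ℕ => -(n : ℤ)) := fun m n h => by simpa using h
  refine ⟨fun k => (if 0 ≤ k then α k.toNat else 0) +
    (if k ≤ 0 then (starRingEnd ℂ) (β (-k).toNat) else 0), fun z hz => ?_⟩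
  have s1 : HasSum (fun k : ℤ => (if 0 ≤ k then α k.toNat else 0) * harmonicMonomial k z)
      ((F z + Complex.I * G z) / 2) := by
    refine (Function.Injective.hasSum_iff (Nat.cast_injective (R := ℤ)) fun k hk => ?_).1 ?_
    · rw [if_neg, zero_mul]
      exact fun h => hk ⟨k.toNat, by simpa using h⟩
    · simpa [Function.comp_def, harmonicMonomial_natCast] using hα z hz
  have s2 : HasSum (fun k : ℤ => (if k ≤ 0 then (starRingEnd ℂ) (β (-k).toNat) else 0) *
      harmonicMonomial k z) ((starRingEnd ℂ) ((F z - Complex.I * G z) / 2)) := by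
    refine (Function.Injective.hasSum_iff hinj fun k hk => ?_).1 ?_
    · rw [if_neg, zero_mul]
      exact fun h => hk ⟨(-k).toNat, by simp; omega⟩
    · simpa [Function.comp_def, harmonicMonomial_neg_natCast] using Complex.hasSum_conj'.2 (hβ z hz)
  have e1 := eF (show z ∈ Metric.ball 0 1 by simpa using hz)
  have e2 := eG (show z ∈ Metric.ball 0 1 by simpa using hz)
  simp only [Function.comp_apply, Complex.reCLM_apply, Complex.imCLM_apply] at e1 e2
  have e : h z = (F z + Complex.I * G z) / 2 +
      (starRingEnd ℂ) ((F z - Complex.I * G z) / 2) := by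
    rw [← Complex.re_add_im (h z), ← e1, ← e2, Complex.re_eq_add_conj, Complex.re_eq_add_conj]
    simp only [map_div₀, map_sub, map_mul, Complex.conj_I, map_ofNat]
    ring
  rw [e]
  simpa [add_mul] using s1.add s2

/-- On a smaller disk the series is dominated by a summable one, which may fail on the whole disk.
The cut-off is a radial factor, so orthogonality of the monomials persists. -/
theorem integral_restrict_hasSum_mul_conj {h : ℂ → ℂ} {a : ℤ → ℂ}
    (ha : ∀ z, ‖z‖ < 1 → HasSum (fun k => a k * harmonicMonomial k z) (h z))
    {r : ℝ} (h0 : 0 ≤ r) (hr : r < 1) (k : ℤ) :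
    ∫ z in Metric.ball 0 r, h z * (starRingEnd ℂ) (harmonicMonomial k z) ∂diskMeasure =
      a k * ∫ z in Metric.ball (0 : ℂ) r, (‖z‖ : ℂ) ^ (2 * k.natAbs) ∂diskMeasure := by
  have hms : MeasurableSet (Metric.ball (0 : ℂ) r) := Metric.isOpen_ball.measurableSet
  have hc (j : ℤ) : Continuous fun z =>
      a j * harmonicMonomial j z * (starRingEnd ℂ) (harmonicMonomial k z) :=
    (continuous_const.mul (continuous_harmonicMonomial j)).mul
      (Complex.continuous_conj.comp (continuous_harmonicMonomial k))
  have hb (j : ℤ) : ∀ᵐ z ∂diskMeasure.restrict (Metric.ball (0 : ℂ) r),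
      ‖a j * harmonicMonomial j z * (starRingEnd ℂ) (harmonicMonomial k z)‖ ≤
        ‖a j‖ * r ^ j.natAbs := by
    filter_upwards [ae_restrict_mem hms] with z hz
    rw [mem_ball_zero_iff] at hz
    rw [norm_mul, norm_mul, RCLike.norm_conj, norm_harmonicMonomial, norm_harmonicMonomial]
    have h1 : ‖z‖ ^ k.natAbs ≤ 1 := pow_le_one₀ (norm_nonneg _) (hz.le.trans hr.le)
    have h2 : ‖z‖ ^ j.natAbs ≤ r ^ j.natAbs := by gcongr
    calc _ ≤ ‖a j‖ * ‖z‖ ^ j.natAbs := mul_le_of_le_one_right (by positivity) h1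
      _ ≤ _ := by gcongr
  have hint (j : ℤ) : Integrable (fun z =>
      a j * harmonicMonomial j z * (starRingEnd ℂ) (harmonicMonomial k z))
      (diskMeasure.restrict (Metric.ball (0 : ℂ) r)) :=
    .of_bound (hc j).aestronglyMeasurable _ (hb j)
  have hsum : Summable fun j : ℤ => ‖a j‖ * r ^ j.natAbs := by
    have := (ha r (by rwa [Complex.norm_real, Real.norm_of_nonneg h0])).summable.norm
    simpa [norm_harmonicMonomial, abs_of_nonneg h0] using this
  have key := hasSum_integral_of_summable_integral_norm hint ?_
  · have e : ∫ z in Metric.ball 0 r, h z * (starRingEnd ℂ) (harmonicMonomial k z) ∂diskMeasure =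
        ∫ z in Metric.ball 0 r, ∑' j : ℤ,
          a j * harmonicMonomial j z * (starRingEnd ℂ) (harmonicMonomial k z) ∂diskMeasure := by
      refine setIntegral_congr_fun hms fun z hz => ?_
      exact (((ha z ((mem_ball_zero_iff.1 hz).trans hr)).mul_right _).tsum_eq).symm
    rw [e]
    refine key.unique ?_
    have e2 (j : ℤ) : ∫ z in Metric.ball 0 r,
          a j * harmonicMonomial j z * (starRingEnd ℂ) (harmonicMonomial k z) ∂diskMeasure =
        if j = k then a k * ∫ z in Metric.ball (0 : ℂ) r, (‖z‖ : ℂ) ^ (2 * k.natAbs) ∂diskMeasure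
        else 0 := by
      have h3 := integral_quasihomogeneous_mul_conj_harmonicMonomial j k
        ((Set.Iio r).indicator fun s => (s : ℂ) ^ j.natAbs)
      have e4 (z : ℂ) : quasihomogeneous j ((Set.Iio r).indicator fun s => (s : ℂ) ^ j.natAbs) z *
          (starRingEnd ℂ) (harmonicMonomial k z) = (Metric.ball (0 : ℂ) r).indicator (fun z =>
            harmonicMonomial j z * (starRingEnd ℂ) (harmonicMonomial k z)) z := by
        by_cases hz : ‖z‖ < r <;> simp [Set.indicator, hz, quasihomogeneous, harmonicMonomial]
      simp_rw [e4] at h3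
      rw [integral_indicator hms] at h3
      simp_rw [mul_assoc]
      rw [integral_const_mul, h3]
      split_ifs with hjk
      · subst hjk
        congr 1
        rw [← integral_indicator hms]
        refine integral_congr_ae (.of_forall fun z => ?_)
        by_cases hz : ‖z‖ < r <;> simp [Set.indicator, hz, two_mul, pow_add]
      · simp
    simp_rw [e2]
    exact hasSum_ite_eq k _
  · refine Summable.of_nonneg_of_le (fun j => integral_nonneg fun w => norm_nonneg (_ : ℂ))
      (fun j => ?_) hsum
    have := integral_mono_ae (hint j).norm (integrable_const (‖a j‖ * r ^ j.natAbs)) (hb j)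
    refine this.trans ?_
    rw [integral_const, smul_eq_mul]
    refine mul_le_of_le_one_left (by positivity) ?_
    rw [measureReal_restrict_apply_univ]
    exact measureReal_le_one

theorem tendsto_setIntegral_ball_diskMeasure {f : ℂ → ℂ} (hf : Integrable f diskMeasure) :
    Filter.Tendsto (fun n : ℕ => ∫ z in Metric.ball 0 (1 - 1 / ((n : ℝ) + 1)), f z ∂diskMeasure)
      Filter.atTop (nhds (∫ z, f z ∂diskMeasure)) := by
  have hU : ⋃ n : ℕ, Metric.ball (0 : ℂ) (1 - 1 / ((n : ℝ) + 1)) = Metric.ball 0 1 := by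
    ext z
    simp only [Set.mem_iUnion, mem_ball_zero_iff]
    refine ⟨fun ⟨n, hn⟩ => hn.trans_le (by simp; positivity), fun hz => ?_⟩
    obtain ⟨n, hn⟩ := exists_nat_one_div_lt (sub_pos.2 hz)
    exact ⟨n, by linarith⟩
  have h := tendsto_setIntegral_of_monotone (μ := diskMeasure) (f := f)
    (s := fun n : ℕ => Metric.ball (0 : ℂ) (1 - 1 / ((n : ℝ) + 1)))
    (fun n => Metric.isOpen_ball.measurableSet)
    (fun m n hmn => Metric.ball_subset_ball (by
      have : (m : ℝ) ≤ n := by exact_mod_cast hmn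
      gcongr))
    hf.integrableOn
  rw [hU] at h
  convert h using 2
  refine (setIntegral_eq_integral_of_ae_compl_eq_zero ?_).symm
  filter_upwards [ae_diskMeasure_norm_lt_one] with z hz hz'
  exact absurd (mem_ball_zero_iff.2 hz) hz'

/-- Letting the radius of the smaller disks tend to `1` identifies each inner product with a nonzero
multiple of the corresponding coefficient of the harmonic expansion. -/
theorem eq_zero_of_forall_inner_bergmanMonomial_eq_zero {f : Lp ℂ 2 diskMeasure}
    (hf : f ∈ harmonicBergman)
    (h0 : ∀ k, inner ℂ (bergmanMonomial k : Lp ℂ 2 diskMeasure) f = 0) : f = 0 := by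
  obtain ⟨h, hh, e⟩ := hf
  obtain ⟨a, ha⟩ := exists_hasSum_of_harmonicOnNhd hh
  have hfi : Integrable f diskMeasure := (Lp.memLp f).integrable one_le_two
  have hhi : Integrable h diskMeasure := hfi.congr e
  have ha0 : ∀ k, a k = 0 := by
    intro k
    have t1 := tendsto_setIntegral_ball_diskMeasure (integrable_mul_conj_harmonicMonomial hhi k)
    have t2 := (tendsto_setIntegral_ball_diskMeasure
      (f := fun z => (‖z‖ : ℂ) ^ (2 * k.natAbs)) (by
        refine .of_bound (by fun_prop) 1 ?_
        filter_upwards [ae_diskMeasure_norm_lt_one] with z hz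
        simpa using pow_le_one₀ (norm_nonneg z) hz.le)).const_mul (a k)
    have e1 : ∫ z, h z * (starRingEnd ℂ) (harmonicMonomial k z) ∂diskMeasure = 0 := by
      rw [← h0 k, inner_eq_integral]
      refine integral_congr_ae ?_
      filter_upwards [e] with z hz
      rw [hz]
    rw [e1] at t1
    have e3 (n : ℕ) := integral_restrict_hasSum_mul_conj ha (r := 1 - 1 / ((n : ℝ) + 1))
      (by rw [sub_nonneg, div_le_one (by positivity)]; simp) (by simp; positivity) k
    simp_rw [e3] at t1
    have := tendsto_nhds_unique t2 t1
    rw [integral_norm_pow_diskMeasure] at this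
    refine (mul_eq_zero.1 this).resolve_right (div_ne_zero two_ne_zero ?_)
    norm_cast
  rw [Lp.eq_zero_iff_ae_eq_zero]
  filter_upwards [e, ae_diskMeasure_norm_lt_one] with z hz hz1
  rw [hz, ← (ha z hz1).tsum_eq]
  simp [ha0]

/-- `L²` convergence gives an almost everywhere convergent subsequence of partial sums; pointwise
summability identifies its limit. -/
theorem ae_eq_tsum_of_hasSum_Lp {f : ℤ → Lp ℂ 2 diskMeasure} {g : Lp ℂ 2 diskMeasure}
    (h : HasSum f g) (hs : ∀ᵐ z ∂diskMeasure, Summable fun k => f k z) :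
    g =ᵐ[diskMeasure] fun z => ∑' k, f k z := by
  let e : ℕ ≃ ℤ := (Denumerable.eqv ℤ).symm
  have h1 := (e.hasSum_iff.2 h).tendsto_sum_nat
  obtain ⟨ns, hns, hlim⟩ := (tendstoInMeasure_of_tendsto_Lp h1).exists_seq_tendsto_ae
  have h2 : ∀ᵐ z ∂diskMeasure, ∀ n : ℕ,
      (∑ i ∈ Finset.range n, (f ∘ e) i : Lp ℂ 2 diskMeasure) z =
        ∑ i ∈ Finset.range n, f (e i) z :=
    ae_all_iff.2 fun n => Lp.coeFn_fun_finsetSum _ _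
  filter_upwards [hs, hlim, h2] with z hz hl h2
  simp only [h2] at hl
  have h3 := (e.hasSum_iff.2 hz.hasSum).tendsto_sum_nat.comp hns.tendsto_atTop
  exact tendsto_nhds_unique hl h3

theorem orthonormal_coe_bergmanUnit :
    Orthonormal ℂ fun k => (bergmanUnit k : Lp ℂ 2 diskMeasure) :=
  orthonormal_bergmanUnit.comp_linearIsometry harmonicBergman.subtypeₗᵢ

/-- The `c k` are bounded and the normalizing factors are at most `|k|+1`, so the series also
converges pointwise on the disk, to a harmonic representative. -/
theorem hasSum_bergmanUnit_mem {c : ℤ → ℂ} (hc : Memℓp c 2) {g : Lp ℂ 2 diskMeasure}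
    (h : HasSum (fun k => c k • (bergmanUnit k : Lp ℂ 2 diskMeasure)) g) :
    g ∈ harmonicBergman := by
  set a : ℤ → ℂ := fun k => c k * ((Real.sqrt (k.natAbs + 1) : ℝ) : ℂ) with ha
  obtain ⟨M, hM⟩ : ∃ M : ℝ, ∀ k, ‖c k‖ ≤ M :=
    ⟨‖(⟨c, hc⟩ : lp (fun _ : ℤ => ℂ) 2)‖,
      fun k => lp.norm_apply_le_norm two_ne_zero (⟨c, hc⟩ : lp (fun _ : ℤ => ℂ) 2) k⟩
  have hsum : ∀ x : ℝ, 0 ≤ x → x < 1 → Summable fun k => ‖a k‖ * x ^ k.natAbs := by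
    intro x h0 hx
    refine Summable.of_nonneg_of_le (fun k => by positivity) (fun k => ?_)
      ((summable_natAbs_succ_mul_pow h0 hx).mul_left M)
    have h1 : Real.sqrt (k.natAbs + 1) ≤ k.natAbs + 1 := by
      rw [Real.sqrt_le_left (by positivity)]
      have : (0 : ℝ) ≤ k.natAbs := by positivity
      nlinarith
    rw [ha, norm_mul, Complex.norm_real, Real.norm_of_nonneg (Real.sqrt_nonneg _), ← mul_assoc]
    have := hM k
    gcongr
    exact (norm_nonneg _).trans this
  have hval : ∀ᵐ z ∂diskMeasure, ∀ k,
      (c k • (bergmanUnit k : Lp ℂ 2 diskMeasure) : Lp ℂ 2 diskMeasure) z =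
        a k * harmonicMonomial k z := by
    refine ae_all_iff.2 fun k => ?_
    have e : (c k • (bergmanUnit k : Lp ℂ 2 diskMeasure) : Lp ℂ 2 diskMeasure) =
        a k • (bergmanMonomial k : Lp ℂ 2 diskMeasure) := by
      rw [ha, bergmanUnit, Submodule.coe_smul, smul_smul]
    rw [e]
    filter_upwards [Lp.coeFn_smul (a k) (bergmanMonomial k : Lp ℂ 2 diskMeasure),
      coeFn_bergmanMonomial k] with z h1 h2
    rw [h1, Pi.smul_apply, h2, smul_eq_mul]
  refine ⟨_, harmonicOnNhd_tsum hsum, (ae_eq_tsum_of_hasSum_Lp h ?_).trans ?_⟩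
  · filter_upwards [hval, ae_diskMeasure_norm_lt_one] with z hz h1
    simp only [hz]
    exact .of_norm (by simpa [norm_harmonicMonomial] using hsum _ (norm_nonneg z) h1)
  · filter_upwards [hval] with z hz
    simp only [hz]

/-- The closed span consists of the `ℓ²` series, which are harmonic. Conversely, a harmonic element
minus its projection to the closed span is harmonic and orthogonal to all monomials, hence zero. -/
theorem topologicalClosure_span_coe_bergmanUnit :
    (Submodule.span ℂ (Set.range fun k => (bergmanUnit k : Lp ℂ 2 diskMeasure))).topologicalClosure
      = harmonicBergman := by
  set v : ℤ → Lp ℂ 2 diskMeasure := fun k => bergmanUnit k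
  have hv : Orthonormal ℂ v := orthonormal_coe_bergmanUnit
  set K := (Submodule.span ℂ (Set.range v)).topologicalClosure with hK
  have hmem : ∀ k, v k ∈ K := fun k =>
    Submodule.le_topologicalClosure _ (Submodule.subset_span ⟨k, rfl⟩)
  have : CompleteSpace K := (Submodule.isClosed_topologicalClosure _).completeSpace_coe
  have hrange : hv.orthogonalFamily.linearIsometry.range = K := by
    rw [OrthogonalFamily.range_linearIsometry, hK, Submodule.span_range_eq_iSup]
    congr 2
    ext k x
    simp [LinearIsometry.toSpanSingleton, Submodule.mem_span_singleton]
  have hle : K ≤ harmonicBergman := by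
    intro f hf
    rw [← hrange] at hf
    obtain ⟨c, rfl⟩ := hf
    exact hasSum_bergmanUnit_mem c.2 (hv.orthogonalFamily.hasSum_linearIsometry c)
  refine le_antisymm hle fun f hf => ?_
  have h0 : f - K.starProjection f = 0 := by
    refine eq_zero_of_forall_inner_bergmanMonomial_eq_zero
      (sub_mem hf (hle (K.starProjection_apply_mem f))) fun k => ?_
    rw [inner_eq_zero_symm]
    refine Submodule.starProjection_inner_eq_zero _ _ ?_
    rw [bergmanMonomial_eq_smul_bergmanUnit]
    exact K.smul_mem _ (hmem k)
  rw [sub_eq_zero.1 h0]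
  exact K.starProjection_apply_mem f

theorem isClosed_harmonicBergman : IsClosed (harmonicBergman : Set (Lp ℂ 2 diskMeasure)) := by
  rw [← topologicalClosure_span_coe_bergmanUnit]
  exact Submodule.isClosed_topologicalClosure _

instance : CompleteSpace harmonicBergman := isClosed_harmonicBergman.completeSpace_coe

/-- The normalized harmonic monomials form a Hilbert basis of the harmonic Bergman space. -/
noncomputable def bergmanBasis : HilbertBasis ℤ ℂ harmonicBergman :=
  HilbertBasis.mkOfOrthogonalEqBot orthonormal_bergmanUnit <| by
    rw [Submodule.eq_bot_iff]
    intro f hf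
    refine Subtype.ext (eq_zero_of_forall_inner_bergmanMonomial_eq_zero f.2 fun k => ?_)
    rw [← Submodule.coe_inner, bergmanMonomial_eq_smul_bergmanUnit]
    exact (Submodule.mem_orthogonal _ _).1 hf _
      (Submodule.smul_mem _ _ (Submodule.subset_span ⟨k, rfl⟩))

@[simp] theorem coe_bergmanBasis : ⇑bergmanBasis = bergmanUnit :=
  HilbertBasis.coe_mkOfOrthogonalEqBot _ _

theorem topologicalClosure_span_bergmanMonomial :
    (Submodule.span ℂ (Set.range bergmanMonomial)).topologicalClosure = ⊤ := by
  rw [← span_range_bergmanUnit, ← coe_bergmanBasis]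
  exact bergmanBasis.dense_span

/-! ### Weighted shifts -/

/-- Multiplication of square summable sequences by a bounded sequence. -/
noncomputable def lpMultiplier {ι : Type*} (w : ι → ℂ) (M : ℝ) (hw : ∀ i, ‖w i‖ ≤ M) :
    lp (fun _ : ι => ℂ) 2 →L[ℂ] lp (fun _ : ι => ℂ) 2 :=
  have hle (c : lp (fun _ : ι => ℂ) 2) (i : ι) : ‖w i * c i‖ ≤ ‖((M : ℂ) • c) i‖ := by
    rw [lp.coeFn_smul, Pi.smul_apply, norm_smul, norm_mul, Complex.norm_real]
    exact mul_le_mul_of_nonneg_right ((hw i).trans (le_abs_self M)) (norm_nonneg _)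
  LinearMap.mkContinuous
    { toFun := fun c => ⟨fun i => w i * c i, (lp.memℓp ((M : ℂ) • c)).mono' (hle c)⟩
      map_add' := fun c d => Subtype.ext (funext fun i => mul_add _ _ _)
      map_smul' := fun a c => by ext i; simp; ring }
    |M| fun c => by
      refine (lp.norm_mono two_ne_zero (hle c)).trans ?_
      rw [norm_smul, Complex.norm_real, Real.norm_eq_abs]

/-- A bounded diagonal operator on `ℓ²`, followed by the isometry onto the shifted orthonormal
family. -/
theorem exists_weightedShift (k : ℤ) (w : ℤ → ℂ) (M : ℝ) (hw : ∀ n, ‖w n‖ ≤ M) :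
    ∃ T : harmonicBergman →L[ℂ] harmonicBergman,
      ∀ n, T (bergmanUnit n) = w n • bergmanUnit (n + k) := by
  have ho : Orthonormal ℂ fun n => bergmanUnit (n + k) :=
    orthonormal_bergmanUnit.comp _ (add_left_injective k)
  refine ⟨ho.orthogonalFamily.linearIsometry.toContinuousLinearMap ∘L lpMultiplier w M hw ∘L
    (bergmanBasis.repr : harmonicBergman →L[ℂ] lp (fun _ : ℤ => ℂ) 2), fun n => ?_⟩
  have h1 : bergmanBasis.repr (bergmanUnit n) = lp.single 2 n (1 : ℂ) := by
    rw [← coe_bergmanBasis]; exact bergmanBasis.repr_self n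
  have h2 : lpMultiplier w M hw (lp.single 2 n (1 : ℂ)) = lp.single 2 n (w n) := by
    ext i
    change w i * (lp.single 2 n (1 : ℂ) : lp (fun _ : ℤ => ℂ) 2) i = _
    rw [lp.single_apply, lp.single_apply]
    rcases eq_or_ne i n with rfl | h <;> simp [*]
  simp [h1, h2]

/-! ### Toeplitz operators with quasihomogeneous symbols -/

theorem IsHarmonicPolynomial.mem_span {h : harmonicBergman} (hh : IsHarmonicPolynomial h) :
    h ∈ Submodule.span ℂ (Set.range bergmanMonomial) := by
  obtain ⟨p, q, hpq⟩ := hh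
  have e : h = p.sum (fun n a => a • bergmanMonomial n) +
      q.sum (fun n a => a • bergmanMonomial (-n)) := by
    apply harmonicBergman_ext
    have h1 : ∀ (p : Polynomial ℂ) (σ : ℕ → ℤ),
        ⇑(p.sum (fun n a => a • bergmanMonomial (σ n)) : harmonicBergman).1 =ᵐ[diskMeasure]
          fun z => p.sum fun n a => a * harmonicMonomial (σ n) z := by
      intro p σ
      simp only [Polynomial.sum, Submodule.coe_sum]
      have : ∀ᵐ z ∂diskMeasure, ∀ n, ((p.coeff n • bergmanMonomial (σ n) : harmonicBergman) :
          Lp ℂ 2 diskMeasure) z = p.coeff n * harmonicMonomial (σ n) z := by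
        refine ae_all_iff.2 fun n => ?_
        filter_upwards [Lp.coeFn_smul (p.coeff n) (bergmanMonomial (σ n) : Lp ℂ 2 diskMeasure),
          coeFn_bergmanMonomial (σ n)] with z h1 h2
        rw [Submodule.coe_smul, h1, Pi.smul_apply, h2, smul_eq_mul]
      filter_upwards [this, Lp.coeFn_fun_finsetSum p.support fun n =>
        ((p.coeff n • bergmanMonomial (σ n) : harmonicBergman) : Lp ℂ 2 diskMeasure)] with z h1 h2
      rw [h2]
      exact Finset.sum_congr rfl fun n _ => h1 n
    refine hpq.trans (.trans ?_ (Lp.coeFn_add _ _).symm)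
    filter_upwards [h1 p (fun n => n), h1 q (fun n => -n)] with z hp hq
    rw [Pi.add_apply, hp, hq]
    simp [harmonicMonomial_natCast, harmonicMonomial_neg_natCast, Polynomial.eval_eq_sum]
  rw [e]
  refine add_mem (Submodule.sum_mem _ fun n _ => ?_) (Submodule.sum_mem _ fun n _ => ?_) <;>
    exact Submodule.smul_mem _ _ (Submodule.subset_span ⟨_, rfl⟩)

/-- Integrability of `u h` is carried through the span induction, since additivity of the projection
depends on it. -/
theorem isToeplitzOperator_of_apply_bergmanMonomial {u : ℂ → ℂ}
    {T : harmonicBergman →L[ℂ] harmonicBergman} (hu : Integrable u diskMeasure)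
    (hT : ∀ n, ⇑(T (bergmanMonomial n) : Lp ℂ 2 diskMeasure) =ᵐ[diskMeasure]
      harmonicProj fun w => u w * harmonicMonomial n w) : IsToeplitzOperator u T := by
  refine ⟨hu, fun h hh => ?_⟩
  suffices H : Integrable (fun w => u w * (h : Lp ℂ 2 diskMeasure) w) diskMeasure ∧
      ⇑(T h : Lp ℂ 2 diskMeasure) =ᵐ[diskMeasure]
        harmonicProj fun w => u w * (h : Lp ℂ 2 diskMeasure) w from H.2
  refine Submodule.span_induction ?_ ?_ ?_ ?_ hh.mem_span
  · rintro _ ⟨n, rfl⟩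
    have e : (fun w => u w * (bergmanMonomial n : Lp ℂ 2 diskMeasure) w) =ᵐ[diskMeasure]
        fun w => u w * harmonicMonomial n w := by
      filter_upwards [coeFn_bergmanMonomial n] with w hw
      rw [hw]
    refine ⟨(integrable_mul_harmonicMonomial hu n).congr e.symm, ?_⟩
    rw [harmonicProj_congr_ae e]
    exact hT n
  · have e : (fun w => u w * ((0 : harmonicBergman) : Lp ℂ 2 diskMeasure) w) =ᵐ[diskMeasure]
        fun _ => 0 := by
      filter_upwards [Lp.coeFn_zero ℂ 2 diskMeasure] with w hw
      rw [Submodule.coe_zero, hw]; simp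
    refine ⟨(integrable_zero _ _ _).congr e.symm, ?_⟩
    rw [harmonicProj_congr_ae e, map_zero]
    filter_upwards [Lp.coeFn_zero ℂ 2 diskMeasure] with w hw
    rw [Submodule.coe_zero, hw]; simp [harmonicProj]
  · rintro f g - - ⟨if_, ef⟩ ⟨ig, eg⟩
    have e : (fun w => u w * ((f + g : harmonicBergman) : Lp ℂ 2 diskMeasure) w) =ᵐ[diskMeasure]
        fun w => u w * (f : Lp ℂ 2 diskMeasure) w + u w * (g : Lp ℂ 2 diskMeasure) w := by
      filter_upwards [Lp.coeFn_add (f : Lp ℂ 2 diskMeasure) (g : Lp ℂ 2 diskMeasure)] with w hw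
      rw [Submodule.coe_add, hw, Pi.add_apply, mul_add]
    refine ⟨(if_.add ig).congr e.symm, ?_⟩
    rw [harmonicProj_congr_ae e, map_add]
    refine (Lp.coeFn_add _ _).trans ?_
    filter_upwards [ef, eg, ae_diskMeasure_norm_lt_one] with z h1 h2 hz
    rw [Pi.add_apply, h1, h2]
    have := ((hasSum_harmonicProj if_ hz).add (hasSum_harmonicProj ig hz))
    refine this.unique ?_
    refine (hasSum_harmonicProj (if_.add ig) hz).congr_fun fun k => ?_
    rw [← mul_add, ← integral_add (integrable_mul_conj_harmonicMonomial if_ k)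
      (integrable_mul_conj_harmonicMonomial ig k)]
    simp [add_mul]
  · rintro a f - ⟨if_, ef⟩
    have e : (fun w => u w * ((a • f : harmonicBergman) : Lp ℂ 2 diskMeasure) w) =ᵐ[diskMeasure]
        fun w => a * (u w * (f : Lp ℂ 2 diskMeasure) w) := by
      filter_upwards [Lp.coeFn_smul a (f : Lp ℂ 2 diskMeasure)] with w hw
      rw [Submodule.coe_smul, hw, Pi.smul_apply, smul_eq_mul]
      ring
    refine ⟨(if_.const_mul a).congr e.symm, ?_⟩
    rw [harmonicProj_congr_ae e, map_smul]
    refine (Lp.coeFn_smul a _).trans ?_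
    filter_upwards [ef] with z h1
    rw [Pi.smul_apply, h1, smul_eq_mul, harmonicProj, harmonicProj, ← integral_const_mul]
    refine integral_congr_ae (.of_forall fun w => ?_)
    beta_reduce
    ring

/-! ### Moments and a rigidity property of powers -/

/-- By Weierstrass approximation, polynomials in `r²` approximate every test function uniformly on
`[0,1]`. -/
theorem ae_eq_zero_of_forall_integral_even_pow_eq_zero {g : ℝ → ℂ}
    (hg : IntegrableOn g (Set.Ioo 0 1))
    (h : ∀ n : ℕ, ∫ r in Set.Ioo (0 : ℝ) 1, ((r ^ (2 * n) : ℝ) : ℂ) * g r = 0) :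
    ∀ᵐ r ∂volume.restrict (Set.Ioo (0 : ℝ) 1), g r = 0 := by
  rw [ae_restrict_iff' measurableSet_Ioo]
  refine isOpen_Ioo.ae_eq_zero_of_integral_contDiff_smul_eq_zero hg.locallyIntegrableOn ?_
  intro η hη hηc hηs
  have hηcont : Continuous η := hη.continuous
  have hpow : ∀ n : ℕ, IntegrableOn (fun r : ℝ => ((r ^ (2 * n) : ℝ) : ℂ) * g r) (Set.Ioo 0 1) := by
    intro n
    refine hg.bdd_mul (c := 1) (by fun_prop) ?_
    filter_upwards [ae_restrict_mem measurableSet_Ioo] with r hr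
    rw [Complex.norm_real, Real.norm_of_nonneg (pow_nonneg hr.1.le _)]
    exact pow_le_one₀ hr.1.le hr.2.le
  have hpoly : ∀ p : Polynomial ℝ,
      IntegrableOn (fun r : ℝ => ((p.eval (r ^ 2) : ℝ) : ℂ) * g r) (Set.Ioo 0 1) ∧
      ∫ r in Set.Ioo (0 : ℝ) 1, ((p.eval (r ^ 2) : ℝ) : ℂ) * g r = 0 := by
    intro p
    induction p using Polynomial.induction_on' with
    | add p q hp hq =>
      simp only [Polynomial.eval_add, Complex.ofReal_add, add_mul]
      exact ⟨hp.1.add hq.1, by rw [integral_add hp.1 hq.1, hp.2, hq.2, add_zero]⟩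
    | monomial n a =>
      simp only [Polynomial.eval_monomial, Complex.ofReal_mul, mul_assoc, ← pow_mul]
      exact ⟨(hpow n).const_mul _, by rw [integral_const_mul, h n, mul_zero]⟩
  have hres : ∫ r, η r • g r = ∫ r in Set.Ioo (0 : ℝ) 1, η r • g r := by
    refine (setIntegral_eq_integral_of_forall_compl_eq_zero fun r hr => ?_).symm
    rw [image_eq_zero_of_notMem_tsupport fun h => hr (hηs h), zero_smul]
  have hηg : IntegrableOn (fun r => η r • g r) (Set.Ioo 0 1) := by
    obtain ⟨C, hC⟩ := hηc.exists_bound_of_continuous hηcont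
    refine (hg.bdd_mul (f := fun r => (η r : ℂ)) (c := C) (by fun_prop)
      (.of_forall fun r => by simpa using hC r)).congr (.of_forall fun r => by simp)
  rw [hres, ← norm_le_zero_iff]
  refine le_of_forall_pos_le_add fun ε hε => ?_
  set A := ∫ r in Set.Ioo (0 : ℝ) 1, ‖g r‖ with hA
  have hA0 : 0 ≤ A := integral_nonneg fun r => norm_nonneg (g r)
  -- Approximating `η(√x)` instead of `η` leaves only even powers after `x = r²`; `A + 1` avoids
  -- dividing by zero.
  obtain ⟨p, hp⟩ := exists_polynomial_near_of_continuousOn 0 1 (fun x => η (Real.sqrt x))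
    (by fun_prop) (ε / (A + 1)) (by positivity)
  have e : ∫ r in Set.Ioo (0 : ℝ) 1, η r • g r =
      ∫ r in Set.Ioo (0 : ℝ) 1, (η r • g r - ((p.eval (r ^ 2) : ℝ) : ℂ) * g r) := by
    rw [integral_sub hηg (hpoly p).1, (hpoly p).2, sub_zero]
  rw [e, zero_add]
  calc _ ≤ ∫ r in Set.Ioo (0 : ℝ) 1, (ε / (A + 1)) * ‖g r‖ := by
        refine norm_integral_le_of_norm_le (hg.norm.const_mul _) ?_
        filter_upwards [ae_restrict_mem measurableSet_Ioo] with r hr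
        have h1 := hp (r ^ 2) ⟨by positivity, pow_le_one₀ hr.1.le hr.2.le⟩
        rw [Real.sqrt_sq hr.1.le] at h1
        rw [Complex.real_smul, ← sub_mul, norm_mul, ← Complex.ofReal_sub, Complex.norm_real,
          Real.norm_eq_abs, abs_sub_comm]
        gcongr
    _ = ε / (A + 1) * A := by rw [integral_const_mul]
    _ ≤ ε := by
        rw [div_mul_eq_mul_div, div_le_iff₀ (by positivity)]
        nlinarith

/-- Fubini on the triangle `r < t`. It absorbs the linear factor of the moment recursion into a
moment of a tail integral. -/
theorem integrable_and_integral_rpow_mul_tail {f : ℝ → ℂ} {q : ℝ} (hq : 0 ≤ q)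
    (hf : IntegrableOn (fun t : ℝ => ((t ^ q : ℝ) : ℂ) * f t) (Set.Ioo 0 1)) :
    IntegrableOn (fun r : ℝ => ((r ^ q : ℝ) : ℂ) * ∫ t in Set.Ioo r 1, f t) (Set.Ioo 0 1) ∧
    ((q + 1 : ℝ) : ℂ) * ∫ r in Set.Ioo (0 : ℝ) 1, ((r ^ q : ℝ) : ℂ) * ∫ t in Set.Ioo r 1, f t =
      ∫ t in Set.Ioo (0 : ℝ) 1, ((t ^ (q + 1) : ℝ) : ℂ) * f t := by
  set ν := volume.restrict (Set.Ioo (0 : ℝ) 1) with hν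
  set g : ℝ → ℂ := fun t => ((t ^ q : ℝ) : ℂ) * f t with hg
  -- Writing `r^q f(t)` as `(r/t)^q · t^q f(t)` gives a factor bounded by `1` times an integrable
  -- function; `f` itself may be non-integrable at `0`.
  set F : ℝ → ℝ → ℂ := fun r t => ((if r < t then (r / t) ^ q else 0 : ℝ) : ℂ) * g t with hF
  have hms : MeasurableSet {p : ℝ × ℝ | p.1 < p.2} := measurableSet_lt measurable_fst measurable_snd
  have hmem : ∀ᵐ p ∂ν.prod ν, p ∈ Set.Ioo (0 : ℝ) 1 ×ˢ Set.Ioo (0 : ℝ) 1 := by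
    rw [hν, Measure.prod_restrict]
    exact ae_restrict_mem (measurableSet_Ioo.prod measurableSet_Ioo)
  have hFint : Integrable (Function.uncurry F) (ν.prod ν) := by
    have h1 : Integrable (fun p : ℝ × ℝ => g p.2) (ν.prod ν) := hf.comp_snd ν
    refine h1.bdd_mul (c := 1)
      (f := fun p : ℝ × ℝ => ((if p.1 < p.2 then (p.1 / p.2) ^ q else 0 : ℝ) : ℂ)) ?_ ?_
    · refine (Complex.measurable_ofReal.comp (Measurable.ite hms ?_ measurable_const)).aestronglyMeasurable
      exact (measurable_fst.div measurable_snd).pow_const q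
    · filter_upwards [hmem] with p hp
      rw [Complex.norm_real]
      split_ifs with hlt
      · rw [Real.norm_of_nonneg (Real.rpow_nonneg (div_nonneg hp.1.1.le hp.2.1.le) _)]
        exact Real.rpow_le_one (div_nonneg hp.1.1.le hp.2.1.le)
          ((div_le_one hp.2.1).2 hlt.le) hq
      · simp
  have hinner : ∀ r ∈ Set.Ioo (0 : ℝ) 1,
      ∫ t, F r t ∂ν = ((r ^ q : ℝ) : ℂ) * ∫ t in Set.Ioo r 1, f t := by
    intro r hr
    have e : Set.Ioo r 1 = Set.Ioo (0 : ℝ) 1 ∩ Set.Ioi r := by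
      ext t; constructor
      · exact fun h => ⟨⟨hr.1.trans h.1, h.2⟩, h.1⟩
      · exact fun h => ⟨h.2, h.1.2⟩
    rw [e, ← setIntegral_indicator measurableSet_Ioi, ← integral_const_mul]
    refine setIntegral_congr_fun measurableSet_Ioo fun t ht => ?_
    by_cases hlt : r < t
    · have h0 : ((t ^ q : ℝ) : ℂ) ≠ 0 := by
        rw [Complex.ofReal_ne_zero]; exact (Real.rpow_pos_of_pos ht.1 q).ne'
      simp only [hF, hg, hlt, if_true, Set.indicator, Set.mem_Ioi]
      rw [Real.div_rpow hr.1.le ht.1.le, Complex.ofReal_div]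
      field_simp
    · simp [hF, hlt, Set.indicator]
  have houter : ∀ t ∈ Set.Ioo (0 : ℝ) 1,
      ∫ r, F r t ∂ν = ((q + 1 : ℝ) : ℂ)⁻¹ * (((t ^ (q + 1) : ℝ) : ℂ) * f t) := by
    intro t ht
    have e : Set.Ioo 0 t = Set.Ioo (0 : ℝ) 1 ∩ Set.Iio t := by
      ext r; constructor
      · exact fun h => ⟨⟨h.1, h.2.trans ht.2⟩, h.2⟩
      · exact fun h => ⟨h.1.1, h.2⟩
    have h0 : ((t ^ q : ℝ) : ℂ) ≠ 0 := by
      rw [Complex.ofReal_ne_zero]; exact (Real.rpow_pos_of_pos ht.1 q).ne'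
    have h1 : ∫ r, F r t ∂ν = ∫ r in Set.Ioo 0 t, ((r ^ q : ℝ) : ℂ) * f t := by
      rw [e, ← setIntegral_indicator measurableSet_Iio]
      refine setIntegral_congr_fun measurableSet_Ioo fun r hr => ?_
      by_cases hlt : r < t
      · simp only [hF, hg, hlt, if_true, Set.indicator, Set.mem_Iio]
        rw [Real.div_rpow hr.1.le ht.1.le, Complex.ofReal_div]
        field_simp
      · simp [hF, hlt, Set.indicator]
    rw [h1, integral_mul_const, integral_complex_ofReal, ← integral_Ioc_eq_integral_Ioo,
      ← intervalIntegral.integral_of_le ht.1.le, integral_rpow (Or.inl (by linarith)),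
      Real.zero_rpow (by linarith), sub_zero]
    push_cast
    ring
  have hsw := integral_integral_swap hFint
  rw [setIntegral_congr_fun measurableSet_Ioo hinner,
    setIntegral_congr_fun measurableSet_Ioo houter, integral_const_mul] at hsw
  refine ⟨?_, ?_⟩
  · refine hFint.integral_prod_left.congr ?_
    filter_upwards [ae_restrict_mem measurableSet_Ioo] with r hr
    exact hinner r hr
  · have : ((q + 1 : ℝ) : ℂ) ≠ 0 := by
      rw [Complex.ofReal_ne_zero]; linarith
    rw [hsw, mul_inv_cancel_left₀ this]

/-- With `H(t)` the tail integral, `H' = -f` and the hypothesis make the derivative of `H / (1 -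
t^a)` vanish. So `H = c(1 - t^a)` and `f = c a t^(a-1)`. -/
theorem exists_const_of_ae_eq_tail {f : ℝ → ℂ} {a : ℝ} (ha : a ≠ 0)
    (hf : ∀ x, 0 < x → IntegrableOn f (Set.Ioo x 1))
    (h : ∀ᵐ t ∂volume.restrict (Set.Ioo (0 : ℝ) 1),
      f t * ((1 - t ^ a : ℝ) : ℂ) = a * ((t ^ (a - 1) : ℝ) : ℂ) * ∫ s in Set.Ioo t 1, f s) :
    ∃ C : ℂ, ∀ᵐ t ∂volume.restrict (Set.Ioo (0 : ℝ) 1), f t = C * ((t ^ (a - 1) : ℝ) : ℂ) := by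
  set H : ℝ → ℂ := fun r => ∫ t in r..1, f t with hH
  have hH' : ∀ r ∈ Set.Ioo (0 : ℝ) 1, ∫ t in Set.Ioo r 1, f t = H r := fun r hr => by
    simp only [hH]
    rw [intervalIntegral.integral_of_le hr.2.le, integral_Ioc_eq_integral_Ioo]
  have hne : ∀ t ∈ Set.Ioo (0 : ℝ) 1, ((1 - t ^ a : ℝ) : ℂ) ≠ 0 := by
    intro t ht
    rw [Complex.ofReal_ne_zero, sub_ne_zero]
    intro h1
    rcases lt_or_gt_of_ne ha with ha | ha
    · exact (Real.one_lt_rpow_of_pos_of_lt_one_of_neg ht.1 ht.2 ha).ne h1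
    · exact (Real.rpow_lt_one ht.1.le ht.2 ha).ne' h1
  -- A continuous representative of `f`, so that `H` is differentiable at every point rather than
  -- almost everywhere.
  set f₀ : ℝ → ℂ := fun t => a * ((t ^ (a - 1) : ℝ) : ℂ) * H t / ((1 - t ^ a : ℝ) : ℂ) with hf₀
  have hff₀ : ∀ᵐ t ∂volume.restrict (Set.Ioo (0 : ℝ) 1), f t = f₀ t := by
    filter_upwards [h, ae_restrict_mem measurableSet_Ioo] with t ht hmem
    rw [hH' t hmem] at ht
    rw [hf₀, eq_div_iff (hne t hmem), ht]
  have hii : ∀ x ∈ Set.Ioo (0 : ℝ) 1, IntervalIntegrable f volume x 1 := fun x hx => by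
    rw [intervalIntegrable_iff_integrableOn_Ioo_of_le hx.2.le]
    exact hf x hx.1
  have hHc : ContinuousOn H (Set.Ioo 0 1) := by
    intro x hx
    obtain ⟨y, hy0, hyx⟩ := exists_between hx.1
    have h1 : ContinuousOn H (Set.uIcc y 1) :=
      intervalIntegral.continuousOn_primitive_interval_left (by
        rw [Set.uIcc_of_le (hyx.trans hx.2).le, integrableOn_Icc_iff_integrableOn_Ioo]
        exact hf y hy0)
    rw [Set.uIcc_of_le (hyx.trans hx.2).le] at h1
    exact (h1.continuousAt (Icc_mem_nhds hyx hx.2)).continuousWithinAt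
  have hpow : ∀ b : ℝ, ContinuousOn (fun t : ℝ => ((t ^ b : ℝ) : ℂ)) (Set.Ioo 0 1) := fun b =>
    Complex.continuous_ofReal.comp_continuousOn fun t ht =>
      (Real.continuousAt_rpow_const t b (Or.inl ht.1.ne')).continuousWithinAt
  have hf₀c : ContinuousOn f₀ (Set.Ioo 0 1) := by
    refine ((continuousOn_const.mul (hpow _)).mul hHc).div ?_ hne
    simp only [Complex.ofReal_sub, Complex.ofReal_one]
    exact continuousOn_const.sub (hpow a)
  have hdist : ∀ x ∈ Set.Ioo (0 : ℝ) 1, (f =ᵐ[volume.restrict (Set.Ioc x 1)] f₀) := by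
    intro x hx
    rw [Filter.EventuallyEq, ← restrict_Ioo_eq_restrict_Ioc]
    exact ae_restrict_of_ae_restrict_of_subset (Set.Ioo_subset_Ioo_left hx.1.le) hff₀
  have hHeq : ∀ x ∈ Set.Ioo (0 : ℝ) 1, H x = ∫ t in x..1, f₀ t := by
    intro x hx
    simp only [hH]
    rw [intervalIntegral.integral_of_le hx.2.le, intervalIntegral.integral_of_le hx.2.le]
    exact integral_congr_ae (hdist x hx)
  have hderiv : ∀ x ∈ Set.Ioo (0 : ℝ) 1, HasDerivAt H (-f₀ x) x := by
    intro x hx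
    have hi : IntervalIntegrable f₀ volume x 1 := by
      rw [intervalIntegrable_iff_integrableOn_Ioc_of_le hx.2.le]
      exact ((intervalIntegrable_iff_integrableOn_Ioc_of_le hx.2.le).1 (hii x hx)).congr
        (hdist x hx)
    refine (intervalIntegral.integral_hasDerivAt_left hi
      (hf₀c.stronglyMeasurableAtFilter isOpen_Ioo x hx)
      (hf₀c.continuousAt (isOpen_Ioo.mem_nhds hx))).congr_of_eventuallyEq ?_
    filter_upwards [isOpen_Ioo.mem_nhds hx] with y hy using hHeq y hy
  have hquot : ∀ x ∈ Set.Ioo (0 : ℝ) 1,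
      HasDerivAt (fun t => H t / ((1 - t ^ a : ℝ) : ℂ)) 0 x := by
    intro x hx
    have h1 : HasDerivAt (fun t : ℝ => ((1 - t ^ a : ℝ) : ℂ))
        ((-(a * x ^ (a - 1)) : ℝ) : ℂ) x :=
      ((Real.hasDerivAt_rpow_const (Or.inl hx.1.ne')).const_sub 1).ofReal_comp
    have h2 := (hderiv x hx).div h1 (hne x hx)
    have e : -f₀ x * ((1 - x ^ a : ℝ) : ℂ) - H x * ((-(a * x ^ (a - 1)) : ℝ) : ℂ) = 0 := by
      have := hne x hx
      simp only [hf₀]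
      field_simp
      push_cast
      ring
    rw [e, zero_div] at h2
    exact h2
  have hconst : ∀ x ∈ Set.Ioo (0 : ℝ) 1, H x / ((1 - x ^ a : ℝ) : ℂ) =
      H (1 / 2) / ((1 - (1 / 2) ^ a : ℝ) : ℂ) := fun x hx =>
    isOpen_Ioo.is_const_of_deriv_eq_zero isPreconnected_Ioo
      (fun y hy => (hquot y hy).differentiableAt.differentiableWithinAt)
      (fun y hy => (hquot y hy).deriv) hx ⟨by norm_num, by norm_num⟩
  refine ⟨a * (H (1 / 2) / ((1 - (1 / 2) ^ a : ℝ) : ℂ)), ?_⟩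
  filter_upwards [hff₀, ae_restrict_mem measurableSet_Ioo] with t ht hmem
  rw [ht, hf₀, ← hconst t hmem]
  ring

theorem integrableOn_rpow_mul {φ : ℝ → ℂ}
    (hφ : IntegrableOn (fun r : ℝ => (r : ℂ) * φ r) (Set.Ioo 0 1)) {s : ℝ} (hs : 1 ≤ s) :
    IntegrableOn (fun r : ℝ => ((r ^ s : ℝ) : ℂ) * φ r) (Set.Ioo 0 1) := by
  refine (hφ.bdd_mul (c := 1) (f := fun r : ℝ => ((r ^ (s - 1) : ℝ) : ℂ))
    (Complex.measurable_ofReal.comp (measurable_id.pow_const _)).aestronglyMeasurable ?_).congr ?_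
  · filter_upwards [ae_restrict_mem measurableSet_Ioo] with r hr
    rw [Complex.norm_real, Real.norm_of_nonneg (Real.rpow_nonneg hr.1.le _)]
    exact Real.rpow_le_one hr.1.le hr.2.le (by linarith)
  · filter_upwards [ae_restrict_mem measurableSet_Ioo] with r hr
    rw [← mul_assoc, ← Complex.ofReal_mul, ← Real.rpow_add_one hr.1.ne', sub_add_cancel]

theorem ofReal_rpow_mul_rpow {t : ℝ} (ht : 0 < t) {x y z : ℝ} (h : x + y = z) :
    ((t ^ x : ℝ) : ℂ) * ((t ^ y : ℝ) : ℂ) = ((t ^ z : ℝ) : ℂ) := by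
  rw [← Complex.ofReal_mul, ← Real.rpow_add ht, h]

/-- A function whose moments satisfy the recursion of the moments of `r ^ κ` along an arithmetic
progression is a multiple of `r ^ κ`. -/
theorem exists_const_of_moment_recursion {φ : ℝ → ℂ}
    (hφ : IntegrableOn (fun r : ℝ => (r : ℂ) * φ r) (Set.Ioo 0 1)) {κ a : ℝ} (ha : a ≠ 0)
    {N₀ : ℕ} (h : ∀ N : ℕ, N₀ ≤ N →
      ((2 * N + 2 * κ + 2 : ℝ) : ℂ) *
          ∫ t in Set.Ioo (0 : ℝ) 1, ((t ^ (2 * N + κ + 1) : ℝ) : ℂ) * φ t =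
        ((2 * N + 2 * κ + 2 + a : ℝ) : ℂ) *
          ∫ t in Set.Ioo (0 : ℝ) 1, ((t ^ (2 * N + κ + 1 + a) : ℝ) : ℂ) * φ t) :
    ∃ C : ℂ, ∀ᵐ t ∂volume.restrict (Set.Ioo (0 : ℝ) 1), φ t = C * ((t ^ κ : ℝ) : ℂ) := by
  -- The exponent is chosen so that `2N+2κ+2` times the moment of order `2N+2κ+1` of the tail `H` is
  -- the integral on the right of the recursion.
  set f : ℝ → ℂ := fun t => ((t ^ (a - 1 - κ) : ℝ) : ℂ) * φ t with hf
  set H : ℝ → ℂ := fun r => ∫ t in Set.Ioo r 1, f t with hH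
  -- From `N₁` on, every power multiplying `φ` has exponent at least `1`, and `2N+2κ+1 ≥ 0`.
  obtain ⟨N₁, hN₁⟩ := exists_nat_ge (2 * |κ| + |a| + 1)
  have hκ := neg_abs_le κ
  have ha' := neg_abs_le a
  have hκ0 := abs_nonneg κ
  have ha0 := abs_nonneg a
  have htail : ∀ N : ℕ, N₁ ≤ N →
      IntegrableOn (fun r : ℝ => ((r ^ (2 * N + 2 * κ + 1) : ℝ) : ℂ) * H r) (Set.Ioo 0 1) ∧
      ((2 * N + 2 * κ + 1 + 1 : ℝ) : ℂ) *
        ∫ r in Set.Ioo (0 : ℝ) 1, ((r ^ (2 * N + 2 * κ + 1) : ℝ) : ℂ) * H r =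
      ∫ t in Set.Ioo (0 : ℝ) 1, ((t ^ (2 * N + κ + 1 + a) : ℝ) : ℂ) * φ t := by
    intro N hN
    have hN' : (N₁ : ℝ) ≤ N := by exact_mod_cast hN
    have h1 := integrable_and_integral_rpow_mul_tail (f := f) (q := 2 * N + 2 * κ + 1)
      (by linarith) ?_
    · refine ⟨h1.1, h1.2.trans (setIntegral_congr_fun measurableSet_Ioo fun t ht => ?_)⟩
      simp only [hf]
      rw [← mul_assoc, ofReal_rpow_mul_rpow ht.1]
      ring
    · refine (integrableOn_rpow_mul hφ (s := 2 * N + κ + a) (by linarith)).congr_fun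
        (fun t ht => ?_) measurableSet_Ioo
      simp only [hf]
      rw [← mul_assoc, ofReal_rpow_mul_rpow ht.1]
      ring
  set N₂ := max N₀ N₁
  -- With `N = N₂+n`, the moment of `G` of order `2n`, multiplied by `2N+2κ+2`, is the difference of
  -- the two sides of the recursion at `N`. So all even moments of `G` vanish.
  set G : ℝ → ℂ := fun r => ((r ^ (2 * N₂ + κ + 1) : ℝ) : ℂ) * φ r -
    ((r ^ (2 * N₂ + κ + 1 + a) : ℝ) : ℂ) * φ r -
      a * (((r ^ (2 * N₂ + 2 * κ + 1) : ℝ) : ℂ) * H r) with hG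
  have hparts : ∀ N : ℕ, N₂ ≤ N →
      IntegrableOn (fun r : ℝ => ((r ^ (2 * N + κ + 1) : ℝ) : ℂ) * φ r) (Set.Ioo 0 1) ∧
      IntegrableOn (fun r : ℝ => ((r ^ (2 * N + κ + 1 + a) : ℝ) : ℂ) * φ r) (Set.Ioo 0 1) ∧
      IntegrableOn (fun r : ℝ => (a : ℂ) * (((r ^ (2 * N + 2 * κ + 1) : ℝ) : ℂ) * H r))
        (Set.Ioo 0 1) := by
    intro N hN
    have hN1 : N₁ ≤ N := (le_max_right _ _).trans hN
    have hN' : (N₁ : ℝ) ≤ N := by exact_mod_cast hN1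
    exact ⟨integrableOn_rpow_mul hφ (by linarith), integrableOn_rpow_mul hφ (by linarith),
      (htail N hN1).1.const_mul _⟩
  have hG0 : ∀ᵐ r ∂volume.restrict (Set.Ioo (0 : ℝ) 1), G r = 0 := by
    obtain ⟨i1, i2, i3⟩ := hparts N₂ le_rfl
    refine ae_eq_zero_of_forall_integral_even_pow_eq_zero ((i1.sub i2).sub i3) fun n => ?_
    obtain ⟨j1, j2, j3⟩ := hparts (N₂ + n) (Nat.le_add_right _ _)
    have e : ∫ r in Set.Ioo (0 : ℝ) 1, ((r ^ (2 * n) : ℝ) : ℂ) * G r =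
        ∫ r in Set.Ioo (0 : ℝ) 1, (((r ^ (2 * (N₂ + n : ℕ) + κ + 1) : ℝ) : ℂ) * φ r -
          ((r ^ (2 * (N₂ + n : ℕ) + κ + 1 + a) : ℝ) : ℂ) * φ r -
          a * (((r ^ (2 * (N₂ + n : ℕ) + 2 * κ + 1) : ℝ) : ℂ) * H r)) := by
      refine setIntegral_congr_fun measurableSet_Ioo fun r hr => ?_
      have hp : ∀ x y : ℝ, x + 2 * n = y →
          ((r ^ y : ℝ) : ℂ) = ((r ^ (2 * n) : ℝ) : ℂ) * ((r ^ x : ℝ) : ℂ) := by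
        intro x y hxy
        rw [← hxy, ← ofReal_rpow_mul_rpow hr.1 rfl, mul_comm, ← Real.rpow_natCast r (2 * n)]
        push_cast
        rfl
      simp only [hG]
      rw [hp (2 * N₂ + κ + 1) (2 * (N₂ + n : ℕ) + κ + 1) (by push_cast; ring),
        hp (2 * N₂ + κ + 1 + a) (2 * (N₂ + n : ℕ) + κ + 1 + a) (by push_cast; ring),
        hp (2 * N₂ + 2 * κ + 1) (2 * (N₂ + n : ℕ) + 2 * κ + 1) (by push_cast; ring)]
      ring
    have j12 : IntegrableOn (fun r => ((r ^ (2 * (N₂ + n : ℕ) + κ + 1) : ℝ) : ℂ) * φ r -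
        ((r ^ (2 * (N₂ + n : ℕ) + κ + 1 + a) : ℝ) : ℂ) * φ r) (Set.Ioo 0 1) := j1.sub j2
    rw [e, integral_sub j12 j3, integral_sub j1 j2, integral_const_mul]
    have hN1 : N₁ ≤ N₂ + n := (le_max_right _ _).trans (Nat.le_add_right _ _)
    have hN' : (N₁ : ℝ) ≤ (N₂ + n : ℕ) := by exact_mod_cast hN1
    have r1 := h (N₂ + n) ((le_max_left _ _).trans (Nat.le_add_right _ _))
    have r2 := (htail (N₂ + n) hN1).2
    have hq : ((2 * (N₂ + n : ℕ) + 2 * κ + 2 : ℝ) : ℂ) ≠ 0 := by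
      rw [Complex.ofReal_ne_zero]
      linarith
    refine (mul_eq_zero.1 ?_).resolve_left hq
    have e3 : ((2 * (N₂ + n : ℕ) + 2 * κ + 1 + 1 : ℝ) : ℂ) =
      ((2 * (N₂ + n : ℕ) + 2 * κ + 2 : ℝ) : ℂ) := by congr 1; ring
    rw [e3] at r2
    rw [mul_sub, mul_sub, r1, mul_left_comm, r2, Complex.ofReal_add _ a]
    ring
  have hfint : ∀ x, 0 < x → IntegrableOn f (Set.Ioo x 1) := by
    intro x hx
    rw [← integrableOn_Icc_iff_integrableOn_Ioo]
    have h1 : IntegrableOn (fun r : ℝ => (r : ℂ) * φ r) (Set.Icc x 1) := by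
      rw [integrableOn_Icc_iff_integrableOn_Ioo]
      exact hφ.mono_set (Set.Ioo_subset_Ioo_left hx.le)
    have h2 : ContinuousOn (fun t : ℝ => ((t ^ (a - 2 - κ) : ℝ) : ℂ)) (Set.Icc x 1) :=
      Complex.continuous_ofReal.comp_continuousOn fun t ht =>
        (Real.continuousAt_rpow_const t _ (Or.inl (hx.trans_le ht.1).ne')).continuousWithinAt
    refine (h1.continuousOn_mul h2 isCompact_Icc).congr_fun (fun t ht => ?_) measurableSet_Icc
    have ht0 := hx.trans_le ht.1
    simp only [hf]
    rw [← mul_assoc, ← Complex.ofReal_mul, ← Real.rpow_add_one ht0.ne']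
    ring_nf
  -- Dividing `G = 0` by `r^(2N₂+2κ+1)` leaves `r^(-κ) φ (1 - r^a) = a H`; multiplying by `r^(a-1)`
  -- gives the tail equation for `f`.
  obtain ⟨C, hC⟩ := exists_const_of_ae_eq_tail ha hfint (by
    filter_upwards [hG0, ae_restrict_mem measurableSet_Ioo] with r hr hmem
    have h1 : ((r ^ (2 * N₂ + 2 * κ + 1) : ℝ) : ℂ) ≠ 0 := by
      rw [Complex.ofReal_ne_zero]; exact (Real.rpow_pos_of_pos hmem.1 _).ne'
    have h2 : ((r ^ (2 * N₂ + 2 * κ + 1) : ℝ) : ℂ) *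
        (((r ^ (-κ) : ℝ) : ℂ) * φ r * ((1 - r ^ a : ℝ) : ℂ) - a * H r) = 0 := by
      rw [← hr, hG]
      beta_reduce
      rw [← ofReal_rpow_mul_rpow hmem.1 (x := 2 * N₂ + 2 * κ + 1) (y := -κ)
          (z := 2 * N₂ + κ + 1) (by ring),
        ← ofReal_rpow_mul_rpow hmem.1 (x := 2 * N₂ + κ + 1) (y := a) rfl,
        ← ofReal_rpow_mul_rpow hmem.1 (x := 2 * N₂ + 2 * κ + 1) (y := -κ)
          (z := 2 * N₂ + κ + 1) (by ring)]
      push_cast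
      ring
    have h3 := sub_eq_zero.1 ((mul_eq_zero.1 h2).resolve_left h1)
    change ((r ^ (a - 1 - κ) : ℝ) : ℂ) * φ r * _ = a * _ * H r
    rw [← ofReal_rpow_mul_rpow hmem.1 (x := a - 1) (y := -κ) (z := a - 1 - κ) (by ring)]
    linear_combination ((r ^ (a - 1) : ℝ) : ℂ) * h3)
  refine ⟨C, ?_⟩
  filter_upwards [hC, ae_restrict_mem measurableSet_Ioo] with t ht hmem
  simp only [hf] at ht
  have h1 : ((t ^ (a - 1 - κ) : ℝ) : ℂ) ≠ 0 := by
    rw [Complex.ofReal_ne_zero]; exact (Real.rpow_pos_of_pos hmem.1 _).ne'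
  refine mul_left_cancel₀ h1 (ht.trans ?_)
  rw [mul_left_comm, ofReal_rpow_mul_rpow hmem.1 (z := a - 1) (by ring)]

/-! ### Radial moments -/

theorem ae_diskMeasure_norm_of_ae {φ ψ : ℝ → ℂ}
    (h : ∀ᵐ r ∂volume.restrict (Set.Ioo (0 : ℝ) 1), φ r = ψ r) :
    ∀ᵐ z ∂diskMeasure, φ ‖z‖ = ψ ‖z‖ := by
  have h0 : (fun r : ℝ => (r : ℂ) * ((‖φ r - ψ r‖ : ℝ) : ℂ)) =ᵐ[volume.restrict (Set.Ioo 0 1)]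
      fun _ => 0 := by
    filter_upwards [h] with r hr
    simp [hr]
  have hi : Integrable (fun z : ℂ => ((‖φ ‖z‖ - ψ ‖z‖‖ : ℝ) : ℂ)) diskMeasure :=
    (integrable_diskMeasure_norm_iff (φ := fun r => ((‖φ r - ψ r‖ : ℝ) : ℂ))).2
      ((integrable_zero _ _ _).congr h0.symm)
  have hz : ∫ z, ((‖φ ‖z‖ - ψ ‖z‖‖ : ℝ) : ℂ) ∂diskMeasure = 0 := by
    rw [integral_diskMeasure_norm (fun r => ((‖φ r - ψ r‖ : ℝ) : ℂ)), integral_congr_ae h0]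
    simp
  rw [integral_complex_ofReal, Complex.ofReal_eq_zero, integral_eq_zero_iff_of_nonneg
    (fun z => norm_nonneg (φ ‖z‖ - ψ ‖z‖)) (by simpa using hi.re)] at hz
  filter_upwards [hz] with z hz
  exact sub_eq_zero.1 (norm_eq_zero.1 hz)

theorem radialMoment_congr_ae {φ ψ : ℝ → ℂ} (h : ∀ᵐ z ∂diskMeasure, φ ‖z‖ = ψ ‖z‖) (d : ℕ) :
    radialMoment φ d = radialMoment ψ d := by
  refine integral_congr_ae ?_
  filter_upwards [h] with z hz
  rw [hz]

theorem radialMoment_rpow_mul (φ : ℝ → ℂ) (m : ℝ) (d : ℕ) :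
    radialMoment (fun r => ((r ^ m : ℝ) : ℂ) * φ r) d =
      2 * ∫ t in Set.Ioo (0 : ℝ) 1, ((t ^ (d + 1 + m) : ℝ) : ℂ) * φ t := by
  rw [radialMoment, integral_diskMeasure_norm (fun r => ((r ^ m : ℝ) : ℂ) * φ r * (r : ℂ) ^ d)]
  congr 1
  refine setIntegral_congr_fun measurableSet_Ioo fun t ht => ?_
  rw [← ofReal_rpow_mul_rpow ht.1 (x := (d + 1 : ℕ)) (y := m)
    (z := d + 1 + m) (by push_cast; ring),
    Real.rpow_natCast]
  push_cast
  ring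

theorem radialMoment_eq_integral (φ : ℝ → ℂ) (d : ℕ) :
    radialMoment φ d = 2 * ∫ t in Set.Ioo (0 : ℝ) 1, ((t ^ (d + 1 : ℝ) : ℝ) : ℂ) * φ t := by
  simpa using radialMoment_rpow_mul φ 0 d

theorem radialMoment_const_mul_rpow (C : ℂ) {p : ℝ} {d : ℕ} (hp : 0 < d + p + 2) :
    radialMoment (fun r => C * ((r ^ p : ℝ) : ℂ)) d = C * (2 / ((d + p + 2 : ℝ) : ℂ)) := by
  have h := radialMoment_rpow_mul (fun _ => C) p d
  simp_rw [mul_comm _ C] at h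
  rw [h, integral_const_mul, integral_complex_ofReal, ← integral_Ioc_eq_integral_Ioo,
    ← intervalIntegral.integral_of_le zero_le_one, integral_rpow (Or.inl (by linarith)),
    Real.one_rpow, Real.zero_rpow (by linarith), sub_zero]
  rw [show (d : ℝ) + 1 + p + 1 = d + p + 2 by ring]
  push_cast
  ring

theorem integrable_norm_rpow (C : ℂ) {p : ℝ} (hp : -2 < p) :
    Integrable (fun z : ℂ => C * ((‖z‖ ^ p : ℝ) : ℂ)) diskMeasure := by
  rw [integrable_diskMeasure_norm_iff (φ := fun r => C * ((r ^ p : ℝ) : ℂ))]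
  have h1 : IntegrableOn (fun r : ℝ => r ^ (p + 1)) (Set.Ioo 0 1) :=
    (intervalIntegral.integrableOn_Ioo_rpow_iff one_pos).2 (by linarith)
  refine IntegrableOn.congr_fun (h1.ofReal.const_mul C) (fun r hr => ?_) measurableSet_Ioo
  rw [Real.rpow_add_one hr.1.ne']
  simp
  ring

/-- In polar coordinates the integrand is a nonzero multiple of `r^(p+1)`. This is the source of the
bounds on `k₂` in the theorem. -/
theorem neg_two_lt_of_integrable_norm {φ : ℝ → ℂ} (hφ : Integrable (fun z => φ ‖z‖) diskMeasure)
    {C : ℂ} (hC : C ≠ 0) {p : ℝ} (h : ∀ᵐ z ∂diskMeasure, φ ‖z‖ = C * ((‖z‖ ^ p : ℝ) : ℂ)) :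
    -2 < p := by
  have h1 := (integrable_diskMeasure_norm_iff (φ := fun r => C * ((r ^ p : ℝ) : ℂ))).1
    (hφ.congr h)
  have h2 : IntegrableOn (fun r : ℝ => r ^ (p + 1)) (Set.Ioo 0 1) := by
    refine IntegrableOn.congr_fun (h1.const_mul C⁻¹).re (fun r hr => ?_) measurableSet_Ioo
    rw [Real.rpow_add_one hr.1.ne']
    have : C⁻¹ * ((r : ℂ) * (C * ((r ^ p : ℝ) : ℂ))) = ((r ^ p * r : ℝ) : ℂ) := by
      field_simp
      push_cast
      ring
    simp only [this]
    exact Complex.ofReal_re _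
  have := (intervalIntegral.integrableOn_Ioo_rpow_iff one_pos).1 h2
  linarith

/-! ### A boundedness criterion for quasihomogeneous symbols. -/

theorem IsToeplitzOperator.congr_ae {u v : ℂ → ℂ} {T : harmonicBergman →L[ℂ] harmonicBergman}
    (hT : IsToeplitzOperator u T) (h : u =ᵐ[diskMeasure] v) : IsToeplitzOperator v T := by
  refine ⟨hT.1.congr h, fun f hf => ?_⟩
  have e : (fun w => u w * (f : Lp ℂ 2 diskMeasure) w) =ᵐ[diskMeasure]
      fun w => v w * (f : Lp ℂ 2 diskMeasure) w := by
    filter_upwards [h] with w hw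
    rw [hw]
  rw [← harmonicProj_congr_ae e]
  exact hT.2 f hf

/-- On normalized monomials the weight is the moment times `√((|n|+1)(|n+k|+1))`. By the
arithmetic-geometric mean inequality the root is at most `d + 2` for `d = |n|+|n+k|`. -/
theorem isTFunction_quasihomogeneous {φ : ℝ → ℂ}
    (hφ : Integrable (fun z => φ ‖z‖) diskMeasure) {M : ℝ}
    (hM : ∀ d : ℕ, ‖radialMoment φ d‖ * (d + 2) ≤ M) (k : ℤ) :
    IsTFunction (quasihomogeneous k φ) := by
  have hs (n : ℤ) : ((Real.sqrt (n.natAbs + 1) : ℝ) : ℂ) ≠ 0 := by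
    rw [Complex.ofReal_ne_zero]; positivity
  have hs2 (n : ℤ) : ((Real.sqrt (n.natAbs + 1) : ℝ) : ℂ) * ((Real.sqrt (n.natAbs + 1) : ℝ) : ℂ) =
      n.natAbs + 1 := by
    rw [← Complex.ofReal_mul, Real.mul_self_sqrt (by positivity)]
    push_cast
    rfl
  obtain ⟨T, hT⟩ := exists_weightedShift k
    (fun n => radialMoment φ (n.natAbs + (n + k).natAbs) *
      (((Real.sqrt (n.natAbs + 1) : ℝ) : ℂ) * ((Real.sqrt ((n + k).natAbs + 1) : ℝ) : ℂ))) M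
    fun n => by
      have h1 := Real.mul_self_sqrt (show (0 : ℝ) ≤ n.natAbs + 1 by positivity)
      have h2 := Real.mul_self_sqrt (show (0 : ℝ) ≤ (n + k).natAbs + 1 by positivity)
      rw [norm_mul, norm_mul, Complex.norm_real, Complex.norm_real,
        Real.norm_of_nonneg (Real.sqrt_nonneg _), Real.norm_of_nonneg (Real.sqrt_nonneg _)]
      refine le_trans ?_ (hM (n.natAbs + (n + k).natAbs))
      refine mul_le_mul_of_nonneg_left ?_ (norm_nonneg _)
      push_cast
      nlinarith [sq_nonneg (Real.sqrt (n.natAbs + 1) - Real.sqrt ((n + k).natAbs + 1)),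
        Real.sqrt_nonneg ((n.natAbs : ℝ) + 1), Real.sqrt_nonneg (((n + k).natAbs : ℝ) + 1)]
  refine ⟨T, isToeplitzOperator_of_apply_bergmanMonomial
    ((integrable_quasihomogeneous_iff k φ).2 hφ) fun n => ?_⟩
  have e : T (bergmanMonomial n) = ((((n + k).natAbs : ℂ) + 1) *
      radialMoment φ (n.natAbs + (n + k).natAbs)) • bergmanMonomial (n + k) := by
    rw [bergmanMonomial_eq_smul_bergmanUnit, map_smul, hT, bergmanUnit, smul_smul, smul_smul,
      ← hs2 (n + k)]
    congr 1
    have := hs n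
    field_simp
  rw [e]
  refine (Lp.coeFn_smul _ _).trans ?_
  filter_upwards [ae_diskMeasure_norm_lt_one, coeFn_bergmanMonomial (n + k)] with z hz h2
  rw [harmonicProj_quasihomogeneous_mul_harmonicMonomial hφ k n hz, Pi.smul_apply, h2, smul_eq_mul]

theorem isTFunction_quasihomogeneous_rpow (k : ℤ) (C : ℂ) {p : ℝ} (hp : -1 ≤ p) :
    IsTFunction (quasihomogeneous k fun r => C * ((r ^ p : ℝ) : ℂ)) := by
  -- Since `p ≥ -1`, `d+p+2 ≥ (d+2)/2`, so `2(d+2)/(d+p+2) ≤ 4`.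
  refine isTFunction_quasihomogeneous (integrable_norm_rpow C (by linarith)) (M := ‖C‖ * 4)
    (fun d => ?_) k
  have hd : (0 : ℝ) ≤ d := by positivity
  have h1 : 0 < d + p + 2 := by linarith
  rw [radialMoment_const_mul_rpow C h1, norm_mul, mul_assoc, norm_div, Complex.norm_real,
    Real.norm_of_nonneg h1.le, Complex.norm_ofNat]
  refine mul_le_mul_of_nonneg_left ?_ (norm_nonneg _)
  rw [div_mul_eq_mul_div, div_le_iff₀ h1]
  linarith

/-! ### Semicommutators -/

/-- The coefficient of the semicommutator of Toeplitz operators with quasihomogeneous symbols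
`e^{ik₁θ}ψ` and `e^{ik₂θ}φ` on the harmonic monomial of degree `n`. -/
noncomputable def semicommutatorCoeff (k₁ k₂ : ℤ) (ψ φ : ℝ → ℂ) (n : ℤ) : ℂ :=
  ((n + (k₁ + k₂)).natAbs + 1) *
    (((n + k₂).natAbs + 1) * radialMoment φ (n.natAbs + (n + k₂).natAbs) *
        radialMoment ψ ((n + k₂).natAbs + (n + (k₁ + k₂)).natAbs) -
      radialMoment (fun r => ψ r * φ r) (n.natAbs + (n + (k₁ + k₂)).natAbs))

theorem semicommutator_apply_bergmanMonomial {k₁ k₂ : ℤ} {ψ φ : ℝ → ℂ}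
    {Tf Tg Tfg : harmonicBergman →L[ℂ] harmonicBergman}
    (hf : IsToeplitzOperator (quasihomogeneous k₁ ψ) Tf)
    (hg : IsToeplitzOperator (quasihomogeneous k₂ φ) Tg)
    (hfg : IsToeplitzOperator (fun z => quasihomogeneous k₁ ψ z * quasihomogeneous k₂ φ z) Tfg)
    (n : ℤ) :
    (Tf ∘L Tg - Tfg) (bergmanMonomial n) =
      semicommutatorCoeff k₁ k₂ ψ φ n • bergmanMonomial (n + (k₁ + k₂)) := by
  simp_rw [quasihomogeneous_mul] at hfg
  have h1 := IsToeplitzOperator.apply_bergmanMonomial hfg n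
  have h2 := hf.apply_bergmanMonomial (n + k₂)
  rw [show n + k₂ + k₁ = n + (k₁ + k₂) by ring] at h2
  rw [sub_apply, ContinuousLinearMap.comp_apply, h1, hg.apply_bergmanMonomial n, map_smul,
    h2, smul_smul, ← sub_smul, semicommutatorCoeff]
  congr 1
  ring

/-- Nonzero weights put linearly independent monomials in the range. Conversely, the preimage of a
finite span is closed and contains all monomials, whose span is dense. -/
theorem hasFiniteRank_iff_of_apply_bergmanMonomial {k : ℤ} {D : ℤ → ℂ}
    {S : harmonicBergman →L[ℂ] harmonicBergman}
    (hS : ∀ n, S (bergmanMonomial n) = D n • bergmanMonomial (n + k)) :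
    HasFiniteRank S ↔ ∃ N : ℕ, ∀ n : ℤ, N ≤ n.natAbs → D n = 0 := by
  constructor
  · intro h
    have : FiniteDimensional ℂ (LinearMap.range (S : harmonicBergman →ₗ[ℂ] harmonicBergman)) := h
    have hfin : {n | D n ≠ 0}.Finite := by
      have hmem (n : {n | D n ≠ 0}) : bergmanMonomial (n + k) ∈
          LinearMap.range (S : harmonicBergman →ₗ[ℂ] harmonicBergman) := by
        refine ⟨(D n)⁻¹ • bergmanMonomial n, ?_⟩
        rw [map_smul, ContinuousLinearMap.coe_coe, hS, smul_smul, inv_mul_cancel₀ n.2, one_smul]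
      have hli : LinearIndependent ℂ fun n : {n | D n ≠ 0} =>
          (⟨bergmanMonomial (n + k), hmem n⟩ :
            LinearMap.range (S : harmonicBergman →ₗ[ℂ] harmonicBergman)) := by
        refine LinearIndependent.of_comp (Submodule.subtype _) ?_
        exact linearIndependent_bergmanMonomial.comp (fun n : {n | D n ≠ 0} => (n : ℤ) + k)
          fun a b hab => Subtype.ext (add_right_cancel hab)
      have := hli.finite
      exact Set.toFinite _
    obtain ⟨N, hN⟩ := (hfin.image Int.natAbs).bddAbove
    refine ⟨N + 1, fun n hn => ?_⟩
    by_contra h0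
    have := hN ⟨n, h0, rfl⟩
    omega
  · rintro ⟨N, hN⟩
    set W : Submodule ℂ harmonicBergman :=
      Submodule.span ℂ ((fun n => bergmanMonomial (n + k)) '' Set.Icc (-N : ℤ) N) with hW
    have hWfin : FiniteDimensional ℂ W :=
      FiniteDimensional.span_of_finite ℂ ((Set.finite_Icc _ _).image _)
    have hclosed : IsClosed (W.comap (S : harmonicBergman →ₗ[ℂ] harmonicBergman) :
        Set harmonicBergman) := W.closed_of_finiteDimensional.preimage S.continuous
    have htop : ⊤ ≤ W.comap (S : harmonicBergman →ₗ[ℂ] harmonicBergman) := by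
      rw [← topologicalClosure_span_bergmanMonomial]
      refine Submodule.topologicalClosure_minimal _ (Submodule.span_le.2 ?_) hclosed
      rintro _ ⟨n, rfl⟩
      rw [SetLike.mem_coe, Submodule.mem_comap, ContinuousLinearMap.coe_coe, hS]
      by_cases hn : N ≤ n.natAbs
      · rw [hN n hn, zero_smul]
        exact zero_mem _
      · exact Submodule.smul_mem _ _ (Submodule.subset_span ⟨n, ⟨by omega, by omega⟩, rfl⟩)
    have hle : LinearMap.range (S : harmonicBergman →ₗ[ℂ] harmonicBergman) ≤ W := by
      rintro _ ⟨f, rfl⟩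
      exact htop (Submodule.mem_top (x := f))
    exact Submodule.finiteDimensional_of_le hle

theorem natAbs_sign_mul_add {σ : ℤ} (hσ : σ = 1 ∨ σ = -1) {N : ℕ} {k : ℤ} (h : k.natAbs ≤ N) :
    ((σ * N + k).natAbs : ℤ) = N + σ * k := by
  rcases hσ with rfl | rfl <;> omega

/-! ### Finite rank forces a power. -/

theorem exists_ae_eq_rpow_of_hasFiniteRank {k₁ k₂ : ℤ} {m : ℝ} (hm : -1 ≤ m) {φ : ℝ → ℂ}
    (hφ : Integrable (fun z => φ ‖z‖) diskMeasure) {σ : ℤ} (hσ : σ = 1 ∨ σ = -1)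
    (h : SemicommutatorHasFiniteRank
      (quasihomogeneous k₁ (fun r => ((r ^ m : ℝ) : ℂ))) (quasihomogeneous k₂ φ))
    (ha : (σ * k₁ : ℤ) + m ≠ 0) :
    ∃ C : ℂ, ∀ᵐ z ∂diskMeasure, φ ‖z‖ = C * ((‖z‖ ^ ((σ * k₂ : ℤ) : ℝ) : ℝ) : ℂ) := by
  obtain ⟨Tf, Tg, Tfg, hf, hg, hfg, hfin⟩ := h
  obtain ⟨N₀, hN₀⟩ := (hasFiniteRank_iff_of_apply_bergmanMonomial
    (semicommutator_apply_bergmanMonomial hf hg hfg)).1 hfin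
  obtain ⟨C, hC⟩ := exists_const_of_moment_recursion
    (integrable_diskMeasure_norm_iff.1 hφ) (κ := (σ * k₂ : ℤ)) ha
    (N₀ := N₀ + k₁.natAbs + k₂.natAbs) fun N hN => by
    -- For `n = σN` with `N ≥ |k₁|+|k₂|`, the absolute values of `n`, `n+k₂` and `n+k₁+k₂` are
    -- affine in `N`.
    have hD := hN₀ (σ * N) (by rcases hσ with rfl | rfl <;> omega)
    have a0 : (σ * N).natAbs = N := by rcases hσ with rfl | rfl <;> omega
    have a1 := natAbs_sign_mul_add hσ (show k₂.natAbs ≤ N by omega)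
    have a2 := natAbs_sign_mul_add hσ (show (k₁ + k₂).natAbs ≤ N by omega)
    have a1' : ((σ * N + k₂).natAbs : ℝ) = N + (σ * k₂ : ℤ) := by
      rw [← Int.cast_natCast, a1, Int.cast_add, Int.cast_natCast]
    have a2' : ((σ * N + (k₁ + k₂)).natAbs : ℝ) = N + (σ * k₂ : ℤ) + (σ * k₁ : ℤ) := by
      rw [← Int.cast_natCast, a2]
      push_cast
      ring
    have hden : 0 < (((σ * N + k₂).natAbs + (σ * N + (k₁ + k₂)).natAbs : ℕ) : ℝ) + m + 2 := by
      have : (0 : ℝ) ≤ ((σ * N + k₂).natAbs + (σ * N + (k₁ + k₂)).natAbs : ℕ) := by positivity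
      linarith
    have hψ := radialMoment_const_mul_rpow 1 hden
    simp only [one_mul] at hψ
    have hne : (((σ * N + (k₁ + k₂)).natAbs : ℂ) + 1) ≠ 0 := by norm_cast
    rw [semicommutatorCoeff, hψ, radialMoment_rpow_mul, radialMoment_eq_integral, a0] at hD
    have hD' := sub_eq_zero.1 ((mul_eq_zero.1 hD).resolve_left hne)
    have e1 : (((N + (σ * N + k₂).natAbs : ℕ) : ℝ) + 1) = 2 * N + (σ * k₂ : ℤ) + 1 := by
      push_cast [a1']; ring
    have e2 : (((N + (σ * N + (k₁ + k₂)).natAbs : ℕ) : ℝ) + 1 + m) =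
        2 * N + (σ * k₂ : ℤ) + 1 + ((σ * k₁ : ℤ) + m) := by
      push_cast [a2']; ring
    have e3 : (((σ * N + k₂).natAbs + (σ * N + (k₁ + k₂)).natAbs : ℕ) : ℝ) + m + 2 =
        2 * N + 2 * (σ * k₂ : ℤ) + 2 + ((σ * k₁ : ℤ) + m) := by
      push_cast [a1', a2']; ring
    have e4 : ((σ * N + k₂).natAbs : ℂ) + 1 = ((N + (σ * k₂ : ℤ) + 1 : ℝ) : ℂ) := by
      rw [← a1']; push_cast; rfl
    rw [e3] at hden
    rw [e1, e2, e3, e4] at hD'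
    have hne3 : ((2 * N + 2 * (σ * k₂ : ℤ) + 2 + ((σ * k₁ : ℤ) + m) : ℝ) : ℂ) ≠ 0 := by
      rw [Complex.ofReal_ne_zero]; exact hden.ne'
    generalize ((2 * N + 2 * (σ * k₂ : ℤ) + 2 + ((σ * k₁ : ℤ) + m) : ℝ) : ℂ) = x at hD' hne3 ⊢
    rw [show (2 * N + 2 * (σ * k₂ : ℤ) + 2 : ℝ) = 2 * (N + (σ * k₂ : ℤ) + 1) by ring,
      Complex.ofReal_mul]
    generalize ∫ t in Set.Ioo (0 : ℝ) 1, ((t ^ (2 * N + (σ * k₂ : ℤ) + 1 : ℝ) : ℝ) : ℂ) * φ t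
      = I₁ at hD' ⊢
    generalize ∫ t in Set.Ioo (0 : ℝ) 1,
      ((t ^ (2 * N + (σ * k₂ : ℤ) + 1 + ((σ * k₁ : ℤ) + m) : ℝ) : ℝ) : ℂ) * φ t = I₂ at hD' ⊢
    generalize ((N + (σ * k₂ : ℤ) + 1 : ℝ) : ℂ) = y at hD' ⊢
    field_simp at hD'
    push_cast
    linear_combination hD'
  exact ⟨C, ae_diskMeasure_norm_of_ae hC⟩

/-- Equal moments of order `d` give `C(d-p+2) = C'(d+p+2)`. Two consecutive `d` yield `C = C'`, and
then `C p = 0`. -/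
theorem eq_zero_of_ae_eq_rpow {φ : ℝ → ℂ} {C C' : ℂ} {p : ℝ} (hp : p ≠ 0)
    (h : ∀ᵐ z ∂diskMeasure, φ ‖z‖ = C * ((‖z‖ ^ p : ℝ) : ℂ))
    (h' : ∀ᵐ z ∂diskMeasure, φ ‖z‖ = C' * ((‖z‖ ^ (-p) : ℝ) : ℂ)) : C = 0 := by
  have key : ∀ d : ℕ, |p| < d → C * ((d - p + 2 : ℝ) : ℂ) = C' * ((d + p + 2 : ℝ) : ℂ) := by
    intro d hd
    have h1 : 0 < d + p + 2 := by linarith [neg_abs_le p]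
    have h2 : 0 < d + -p + 2 := by linarith [le_abs_self p]
    have e := (radialMoment_congr_ae (ψ := fun r => C * ((r ^ p : ℝ) : ℂ)) h d).symm.trans
      (radialMoment_congr_ae (ψ := fun r => C' * ((r ^ (-p) : ℝ) : ℂ)) h' d)
    rw [radialMoment_const_mul_rpow C h1, radialMoment_const_mul_rpow C' h2,
      show (d : ℝ) + -p + 2 = d - p + 2 by ring] at e
    have n1 : ((d + p + 2 : ℝ) : ℂ) ≠ 0 := by rw [Complex.ofReal_ne_zero]; exact h1.ne'
    have n2 : ((d - p + 2 : ℝ) : ℂ) ≠ 0 := by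
      rw [Complex.ofReal_ne_zero, sub_eq_add_neg]; exact h2.ne'
    rw [← mul_div_assoc, ← mul_div_assoc, div_eq_div_iff n1 n2] at e
    linear_combination e / 2
  obtain ⟨d, hd⟩ := exists_nat_gt |p|
  have k1 := key d hd
  have k2 := key (d + 1) (by push_cast; linarith)
  push_cast at k1 k2
  have hCC : C = C' := by linear_combination k2 - k1
  subst hCC
  have hp' : (p : ℂ) ≠ 0 := by exact_mod_cast hp
  have : C * p = 0 := by linear_combination -k1 / 2
  exact (mul_eq_zero.1 this).resolve_right hp'

/-! ### Powers give finite rank, and conclusion. -/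

theorem semicommutatorHasFiniteRank_rpow {k₁ k₂ σ : ℤ} (hσ : σ = 1 ∨ σ = -1) (h1 : -1 ≤ σ * k₁)
    (h2 : -1 ≤ σ * k₂) (h12 : -1 ≤ σ * (k₁ + k₂)) {φ : ℝ → ℂ} {C : ℂ}
    (hφ : ∀ᵐ z ∂diskMeasure, φ ‖z‖ = C * ((‖z‖ ^ ((σ * k₂ : ℤ) : ℝ) : ℝ) : ℂ)) :
    SemicommutatorHasFiniteRank
      (quasihomogeneous k₁ (fun r => ((r ^ ((σ * k₁ : ℤ) : ℝ) : ℝ) : ℂ)))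
      (quasihomogeneous k₂ φ) := by
  have hprod : ∀ᵐ z ∂diskMeasure, ((‖z‖ ^ ((σ * k₁ : ℤ) : ℝ) : ℝ) : ℂ) * φ ‖z‖ =
      C * ((‖z‖ ^ ((σ * (k₁ + k₂) : ℤ) : ℝ) : ℝ) : ℂ) := by
    filter_upwards [hφ, ae_diskMeasure_ne_zero] with z hz h0
    rw [hz, mul_left_comm, ofReal_rpow_mul_rpow (norm_pos_iff.2 h0)]
    push_cast
    ring
  obtain ⟨Tf, hf⟩ := isTFunction_quasihomogeneous_rpow k₁ 1 (p := (σ * k₁ : ℤ))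
    (by exact_mod_cast h1)
  obtain ⟨Tg, hg⟩ := isTFunction_quasihomogeneous_rpow k₂ C (p := (σ * k₂ : ℤ))
    (by exact_mod_cast h2)
  obtain ⟨Tfg, hfg⟩ := isTFunction_quasihomogeneous_rpow (k₁ + k₂) C (p := (σ * (k₁ + k₂) : ℤ))
    (by exact_mod_cast h12)
  simp only [one_mul] at hf
  have hg' : IsToeplitzOperator (quasihomogeneous k₂ φ) Tg := hg.congr_ae (by
    filter_upwards [hφ] with z hz
    rw [quasihomogeneous, quasihomogeneous, hz])
  have hfg' : IsToeplitzOperator (fun z =>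
      quasihomogeneous k₁ (fun r => ((r ^ ((σ * k₁ : ℤ) : ℝ) : ℝ) : ℂ)) z *
        quasihomogeneous k₂ φ z) Tfg := hfg.congr_ae (by
    filter_upwards [hprod] with z hz
    rw [quasihomogeneous_mul, quasihomogeneous, quasihomogeneous, hz])
  refine ⟨Tf, Tg, Tfg, hf, hg', hfg', (hasFiniteRank_iff_of_apply_bergmanMonomial
    (semicommutator_apply_bergmanMonomial hf hg' hfg')).2 ⟨k₁.natAbs + k₂.natAbs, ?_⟩⟩
  intro n hn
  have pos : ∀ (d : ℕ) (q : ℤ), -1 ≤ q → (0 : ℝ) < d + (q : ℝ) + 2 := fun d q hq => by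
    have : (-1 : ℝ) ≤ q := by exact_mod_cast hq
    have : (0 : ℝ) ≤ d := by positivity
    linarith
  have r1 := radialMoment_const_mul_rpow 1
    (pos ((n + k₂).natAbs + (n + (k₁ + k₂)).natAbs) _ h1)
  simp only [one_mul] at r1
  rw [semicommutatorCoeff, radialMoment_congr_ae
    (ψ := fun r => C * ((r ^ ((σ * k₂ : ℤ) : ℝ) : ℝ) : ℂ)) hφ, radialMoment_congr_ae
    (φ := fun r => ((r ^ ((σ * k₁ : ℤ) : ℝ) : ℝ) : ℂ) * φ r)
    (ψ := fun r => C * ((r ^ ((σ * (k₁ + k₂) : ℤ) : ℝ) : ℝ) : ℂ)) hprod, r1,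
    radialMoment_const_mul_rpow C (pos _ _ h2), radialMoment_const_mul_rpow C (pos _ _ h12)]
  refine mul_eq_zero_of_right _ ?_
  have p1 := pos ((n + k₂).natAbs + (n + (k₁ + k₂)).natAbs) _ h1
  have p2 := pos (n.natAbs + (n + k₂).natAbs) _ h2
  have p12 := pos (n.natAbs + (n + (k₁ + k₂)).natAbs) _ h12
  -- Vanishing of the weight with denominators cleared. Write `A`, `B`, `D` for the absolute values
  -- of `n`, `n+k₂`, `n+k₁+k₂`. As there is no sign change, both sides are `(2B+2)(2D+2)` if `σn ≥
  -- 0` and `(2B+2)(2A+2)` if `σn ≤ 0`.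
  have key : (2 * ((n + k₂).natAbs + 1) : ℝ) *
      (((n.natAbs + (n + (k₁ + k₂)).natAbs : ℕ) : ℝ) + (σ * (k₁ + k₂) : ℤ) + 2) =
      (((n.natAbs + (n + k₂).natAbs : ℕ) : ℝ) + (σ * k₂ : ℤ) + 2) *
      (((n + k₂).natAbs + (n + (k₁ + k₂)).natAbs : ℕ) + (σ * k₁ : ℤ) + 2) := by
    have : (2 * ((n + k₂).natAbs + 1) : ℤ) *
        (((n.natAbs + (n + (k₁ + k₂)).natAbs : ℕ) : ℤ) + (σ * (k₁ + k₂) : ℤ) + 2) =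
        (((n.natAbs + (n + k₂).natAbs : ℕ) : ℤ) + (σ * k₂ : ℤ) + 2) *
        (((n + k₂).natAbs + (n + (k₁ + k₂)).natAbs : ℕ) + (σ * k₁ : ℤ) + 2) := by
      push_cast
      rcases le_total 0 n with h0 | h0
      · rw [abs_of_nonneg h0, abs_of_nonneg (show 0 ≤ n + k₂ by omega),
          abs_of_nonneg (show 0 ≤ n + (k₁ + k₂) by omega)]
        rcases hσ with rfl | rfl <;> ring
      · rw [abs_of_nonpos h0, abs_of_nonpos (show n + k₂ ≤ 0 by omega),
          abs_of_nonpos (show n + (k₁ + k₂) ≤ 0 by omega)]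
        rcases hσ with rfl | rfl <;> ring
    generalize n.natAbs = A at this ⊢
    generalize (n + k₂).natAbs = B at this ⊢
    generalize (n + (k₁ + k₂)).natAbs = D at this ⊢
    exact_mod_cast this
  have keyC := congrArg (fun x : ℝ => (x : ℂ)) key
  have q1 := Complex.ofReal_ne_zero.2 p1.ne'
  have q2 := Complex.ofReal_ne_zero.2 p2.ne'
  have q12 := Complex.ofReal_ne_zero.2 p12.ne'
  simp only [Complex.ofReal_mul] at keyC
  generalize (((((n.natAbs + (n + (k₁ + k₂)).natAbs : ℕ) : ℝ) + (σ * (k₁ + k₂) : ℤ) + 2 : ℝ)) : ℂ)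
    = x at *
  generalize (((((n.natAbs + (n + k₂).natAbs : ℕ) : ℝ) + (σ * k₂ : ℤ) + 2 : ℝ)) : ℂ) = y at *
  generalize ((((((n + k₂).natAbs + (n + (k₁ + k₂)).natAbs : ℕ) : ℝ) + (σ * k₁ : ℤ) + 2 : ℝ)) : ℂ)
    = w at *
  push_cast at keyC
  field_simp
  linear_combination 2 * C * keyC

theorem ofReal_norm_rpow_intCast (z : ℂ) (k : ℤ) :
    ((‖z‖ ^ (k : ℝ) : ℝ) : ℂ) = (‖z‖ : ℂ) ^ k := by
  rw [Real.rpow_intCast, Complex.ofReal_zpow]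

theorem exponents_of_semicommutator {k₁ k₂ σ : ℤ} {m : ℝ} {φ : ℝ → ℂ}
    (hφ : Integrable (fun z => φ ‖z‖) diskMeasure)
    (hφ0 : ¬ ∀ᵐ z ∂diskMeasure, φ ‖z‖ = 0) (hm : m = (σ * k₁ : ℤ))
    (h : SemicommutatorHasFiniteRank
      (quasihomogeneous k₁ (fun r => ((r ^ m : ℝ) : ℂ))) (quasihomogeneous k₂ φ))
    {C : ℂ} (hC : ∀ᵐ z ∂diskMeasure, φ ‖z‖ = C * ((‖z‖ ^ ((σ * k₂ : ℤ) : ℝ) : ℝ) : ℂ)) :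
    C ≠ 0 ∧ -2 < σ * k₂ ∧ -2 < σ * (k₁ + k₂) := by
  have hC0 : C ≠ 0 := by
    rintro rfl
    exact hφ0 (by simpa using hC)
  obtain ⟨Tf, Tg, Tfg, hf, hg, hfg, -⟩ := h
  refine ⟨hC0, by exact_mod_cast neg_two_lt_of_integrable_norm hφ hC0 hC, ?_⟩
  have hi := hfg.1
  simp_rw [quasihomogeneous_mul] at hi
  have hi' := (integrable_quasihomogeneous_iff _ (fun r => ((r ^ m : ℝ) : ℂ) * φ r)).1 hi
  have := neg_two_lt_of_integrable_norm (φ := fun r => ((r ^ m : ℝ) : ℂ) * φ r)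
    hi' hC0 (p := (σ * (k₁ + k₂) : ℤ)) (by
    filter_upwards [hC, ae_diskMeasure_ne_zero] with z hz h0
    rw [hz, mul_left_comm, ofReal_rpow_mul_rpow (norm_pos_iff.2 h0)]
    rw [hm]
    push_cast
    ring)
  exact_mod_cast this

theorem mainTheorem12 (k₁ k₂ : ℤ) (hk : k₁ * k₂ ≠ 0) (m : ℝ) (hm : -1 ≤ m)
    (φ : ℝ → ℂ) (hφ : IsTFunction (fun z => φ ‖z‖))
    (hφ0 : ¬ ∀ᵐ z ∂diskMeasure, φ ‖z‖ = 0) :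
    SemicommutatorHasFiniteRank
        (quasihomogeneous k₁ (fun r => ((r ^ m : ℝ) : ℂ))) (quasihomogeneous k₂ φ) ↔
      (m = (k₁ : ℝ) ∧ max (-2) (-k₁ - 2) < k₂ ∧
        ∃ C : ℂ, C ≠ 0 ∧ ∀ᵐ z ∂diskMeasure, φ ‖z‖ = C * (‖z‖ : ℂ) ^ k₂) ∨
      (m = -(k₁ : ℝ) ∧ k₂ < min 2 (-k₁ + 2) ∧
        ∃ C : ℂ, C ≠ 0 ∧ ∀ᵐ z ∂diskMeasure, φ ‖z‖ = C * (‖z‖ : ℂ) ^ (-k₂)) := by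
  obtain ⟨hk1, hk2⟩ := mul_ne_zero_iff.1 hk
  obtain ⟨T, hT⟩ := hφ
  have hφi : Integrable (fun z => φ ‖z‖) diskMeasure := hT.1
  constructor
  · intro h
    by_cases ha : (k₁ : ℝ) + m = 0
    · have hm' : m = -(k₁ : ℝ) := by linarith
      have hk1' : (k₁ : ℝ) ≠ 0 := by exact_mod_cast hk1
      obtain ⟨C, hC⟩ := exists_ae_eq_rpow_of_hasFiniteRank hm hφi (Or.inr rfl) h (by
        push_cast
        intro h0
        exact hk1' (by linarith))
      obtain ⟨hC0, e1, e2⟩ := exponents_of_semicommutator (σ := -1) hφi hφ0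
        (by rw [hm']; push_cast; ring) h hC
      refine Or.inr ⟨hm', by omega, C, hC0, ?_⟩
      filter_upwards [hC] with z hz
      rw [hz, ofReal_norm_rpow_intCast, neg_one_mul]
    · obtain ⟨C, hC⟩ := exists_ae_eq_rpow_of_hasFiniteRank hm hφi (Or.inl rfl) h (by
        simpa using ha)
      have hb : m = (k₁ : ℝ) := by
        by_contra hb
        -- If `m` is neither `k₁` nor `-k₁`, both signs apply and `φ` is a multiple of two different
        -- powers, hence zero.
        obtain ⟨C', hC'⟩ := exists_ae_eq_rpow_of_hasFiniteRank hm hφi (Or.inr rfl) h (by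
          push_cast
          intro h0
          exact hb (by linarith))
        have hz := eq_zero_of_ae_eq_rpow (p := (k₂ : ℝ)) (by exact_mod_cast hk2)
          (by simpa using hC) (by simpa using hC')
        subst hz
        exact hφ0 (by simpa using hC)
      obtain ⟨hC0, e1, e2⟩ := exponents_of_semicommutator (σ := 1) hφi hφ0
        (by rw [hb]; push_cast; ring) h hC
      refine Or.inl ⟨hb, by omega, C, hC0, ?_⟩
      filter_upwards [hC] with z hz
      rw [hz, ofReal_norm_rpow_intCast, one_mul]
  · rintro (⟨rfl, hlt, C, -, hC⟩ | ⟨rfl, hlt, C, -, hC⟩)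
    -- The exponents are integers, so the strict bounds by `-2` become the bounds by `-1` that
    -- boundedness uses.
    · have h1 : -1 ≤ k₁ := by exact_mod_cast hm
      have := semicommutatorHasFiniteRank_rpow (k₁ := k₁) (k₂ := k₂) (σ := 1) (Or.inl rfl)
        (by omega) (by omega) (by omega) (C := C) (φ := φ) (by
          filter_upwards [hC] with z hz
          rw [hz, ofReal_norm_rpow_intCast, one_mul])
      simpa using this
    · have h1 : -1 ≤ -k₁ := by exact_mod_cast hm
      have := semicommutatorHasFiniteRank_rpow (k₁ := k₁) (k₂ := k₂) (σ := -1) (Or.inr rfl)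
        (by omega) (by omega) (by omega) (C := C) (φ := φ) (by
          filter_upwards [hC] with z hz
          rw [hz, ofReal_norm_rpow_intCast, neg_one_mul])
      simpa using this
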